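/- Let $G$ be a finite connected undirected multigraph with $n\ge 3$ vertices, $m$ edges and minimum cut value $\lambda$, and let $p\in(0,1)$. A cut $C$ of $G$ is the set of edges crossing a bipartition of the vertex set into two non-empty sides, and $z_G(p)=\sum_{C}p^{|C|}$, the sum being over all cuts of $G$. All logarithms are natural. Let $\delta=\Theta(1/\log\log n)$, i.e. $c_1/\log\log n\le\delta\le c_2/\log\log n$ for fixed constants $c_1,c_2>0$. For a finite sequence $\mathcal S$ of spanning trees let $\ell^{\mathcal S}(e)=|\{T\in\mathcal S: e\in T\}|/|\mathcal S|$ be the induced edge loads ($\ell^{\emptyset}=0$). A greedy tree packing is a sequence $T_1,T_2,\dots$ of spanning trees of $G$ such that each $T_i$ is a minimum spanning tree of $G$ for the edge weights $\ell^{(T_1,\dots,T_{i-1})}$ (ties broken arbitrarily). Let $\mathcal T=(T_{M+1},\dots,T_{2M})$ be the latter half of a greedy tree packing with $2M$ rounds, where $M\ge 6\lambda\ln m/(\delta/3)^2$. For $\tau>0$ let $\tilde k_\tau$ be the number of vertices that are left after contracting all edges $e$ with $\ell^{\mathcal T}(e)<1/\tau$, and let $\pi_i=(1+\delta)^i\lambda/2$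 for $i\ge 0$. For a cut $C$ write $\ell^{\mathcal T}(C)=\sum_{e\in C}\ell^{\mathcal T}(e)$, and let $$z'_G(p)=\sum_{C:\ \ell^{\mathcal T}(C)\le 2\log n}p^{|C|}.$$ Lemma (reliable case). If $n^{1+30\delta}\,\tilde k_{\pi_i}\,p^{2\pi_i}\le 1$ for all integers $i\ge 0$, then $z'_G(p)\ge(1-O(1/n))\,z_G(p)$; that is, $z'_G(p)\ge(1-K/n)\,z_G(p)$ for a constant $K$ that depends only on $c_1$ and $c_2$ (not on $G$, $p$, $\delta$ or $\mathcal T$). -/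

import Mathlib

noncomputable section

namespace Unreliability

variable {V E : Type*} [Fintype V] [Fintype E]

/-- The set `∂S` of the edges of `G` with exactly one end in `S`. -/
def boundary (G : Graph V E) (S : Set V) : Set E :=
  {e | ∃ x y, G.IsLink e x y ∧ x ∈ S ∧ y ∉ S}

/-- A cut of `G`: the set of edges that cross a bipartition of the vertices into two
non-empty sides. (In a connected graph, distinct bipartitions give distinct edge sets.) -/
def IsCut (G : Graph V E) (C : Finset E) : Prop :=
  ∃ S : Set V, S ⊆ G.vertexSet ∧ S.Nonempty ∧ S ≠ G.vertexSet ∧ (C : Set E) = boundary G S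

/-- The value `λ` of a minimum cut of `G`. -/
def minCut (G : Graph V E) : ℕ :=
  sInf {k | ∃ C : Finset E, IsCut G C ∧ C.card = k}

open Classical in
/-- `z_G(p) = ∑_C p^|C|`, the expected number of failed cuts. -/
def zG (G : Graph V E) (p : ℝ) : ℝ :=
  ∑ C : Finset E with IsCut G C, p ^ C.card

open Classical in
/-- The sum of `p^|C|` over the cuts `C` with `ℓ(C) = ∑_{e ∈ C} ℓ(e) ≤ b`. -/
def zGRestricted (G : Graph V E) (ℓ : E → ℝ) (b p : ℝ) : ℝ :=
  ∑ C : Finset E with IsCut G C ∧ ∑ e ∈ C, ℓ e ≤ b, p ^ C.card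

/-- The number of connected components of `(V(G), F)`, that is, the number of vertices that
are left after all the edges of `F` are contracted. -/
def numContracted (G : Graph V E) (F : Set E) : ℕ :=
  Nat.card (G.restrict F).toSimpleGraph.ConnectedComponent

/-- `k_τ` with respect to the loads `ℓ`: the number of vertices that are left after all edges
with `ℓ(e) < 1/τ` are contracted. -/
def kParam (G : Graph V E) (ℓ : E → ℝ) (τ : ℝ) : ℕ :=
  numContracted G {e | ℓ e < 1 / τ}

/-- `T` is the edge set of a spanning tree of `G`: a set of `|V(G)| - 1` edges of `G` that
connects all the vertices. -/
def IsSpanningTree (G : Graph V E) (T : Finset E) : Prop :=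
  (T : Set E) ⊆ G.edgeSet ∧ (G.restrict (T : Set E)).toSimpleGraph.Connected ∧
    T.card + 1 = G.vertexSet.ncard

/-- `T` is a minimum spanning tree of `G` for the edge weights `w`. -/
def IsMinSpanningTree (G : Graph V E) (w : E → ℝ) (T : Finset E) : Prop :=
  IsSpanningTree G T ∧
    ∀ T' : Finset E, IsSpanningTree G T' → ∑ e ∈ T, w e ≤ ∑ e ∈ T', w e

open Classical in
/-- The load `ℓ^𝒯(e) = |{T ∈ 𝒯 : e ∈ T}| / |𝒯|` for the finite family `𝒯 = (T i)_{i ∈ s}`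
(equal to `0` for an empty family). -/
def load {ι : Type*} (T : ι → Finset E) (s : Finset ι) (e : E) : ℝ :=
  ((s.filter fun i => e ∈ T i).card : ℝ) / (s.card : ℝ)

/-- `T 0, …, T (N - 1)` is a run of `N` rounds of greedy tree packing, with ties broken
arbitrarily: each `T i` is a minimum spanning tree of `G` for the loads induced by
`T 0, …, T (i - 1)`. -/
def IsGreedyTreePacking (G : Graph V E) (N : ℕ) (T : ℕ → Finset E) : Prop :=
  ∀ i < N, IsMinSpanningTree G (load T (Finset.range i)) (T i)

/-- The level threshold `π_i = (1 + δ)^i λ / 2`. -/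
def levelPi (G : Graph V E) (δ : ℝ) (i : ℕ) : ℝ :=
  (1 + δ) ^ i * (minCut G : ℝ) / 2

end Unreliability

end

/-!
The proof compares the packing with *ideal loads* `x` and then counts cuts through the trees.

**Ideal loads.** Let `x` be the point of least Euclidean norm in the convex hull of the indicator
vectors of the spanning trees. First-order optimality (`exists_ideal_distribution`) says that `x` is
an average of trees that are minimum spanning trees for the weights `x`. By Kruskal's criterion
(`IsMinSpanningTree.isTight`) such a tree contains a spanning forest of every sublevel set of `x`.
Counting the edges of largest load against the degrees of the components that they separate gives
`x ≤ 2 / λ` (`mixedLoad_mul_minCut_le`).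

**Convergence of the greedy packing.** A minimum spanning tree for the current loads is also one for
every monotone function of them, and it contains a spanning forest of each of their sublevel sets.
The matroid inequality `card_filter_le_of_isTight`, applied to a sublevel set of the current loads
and one of `x`, compares the tree of the current round with the trees that make up `x`. Hence the
potentials `∑ exp (± ε L_e)`, restricted to `{x ≤ θ}` or to `{x ≥ θ}`, grow at most as if each edge
were used at rate `θ`, and after `t ≥ 6 λ log m / (δ / 3) ^ 2` rounds all loads are within
`δ / (2 λ)` of `x` (`abs_load_sub_mixedLoad_le`, `exists_ideal_load_approx`). So the loads `ℓ` of the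
latter half are within `2 δ / λ` of the loads that each of its trees was chosen for, and a tree of
the latter half has at most `k_τ` edges of load more than `1 / τ + 4 δ / λ`
(`card_heavy_le_kParam`).

**Counting cuts.** A cut `C` has `ℓ(C) = avg_T |T ∩ C|` and `|C| ≥ avg_T ∑_{e ∈ T ∩ C} 1 / ℓ e`. If
`ℓ(C) > 2 log n`, then `|C| ≥ λ / η` for `η = 2 / log n`, as all loads are below `4 / λ`. Jensen's
inequality gives
`p ^ |C| ≤ p ^ λ * n ^ (-2) * avg_T ∏_{e ∈ T ∩ C} exp 1 * p ^ ((1 - η) / ℓ e)`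
(`pow_card_le_avg_prod`). Since `C` is determined by `T ∩ C`, the sum over all such `C` is at most
`p ^ λ * n ^ (-2)` times the average of `exp (3 ∑_{e ∈ T} p ^ ((1 - η) / ℓ e))`
(`sum_pow_card_le_of_load`). In the reliable case the inner sum is `O(1 / δ) = O(log log n)`: group
the edges of `T` by the levels `π_i`, each of which contributes at most
`k_{π_i} * p ^ ((1 - 8 δ) π_i) ≤ 1` (`sum_rpow_inv_load_le`). For large `n` the cuts of large load
thus contribute at most `p ^ λ / n ≤ z_G(p) / n`; for the other `n` the factor `1 - K / n` is
negative.
-/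

namespace Unreliability

/-! ### Components, spanning trees and Kruskal's criterion -/

section Connectivity

variable {V E : Type*} {G : Graph V E}

/-- Two vertices are joined by `F` if the edges of `F` contain a path between them. -/
def Joined (G : Graph V E) (F : Set E) (u v : G.vertexSet) : Prop :=
  (G.restrict F).toSimpleGraph.Reachable u v

lemma Joined.refl {F : Set E} (u : G.vertexSet) : Joined G F u u :=
  SimpleGraph.Reachable.refl (G := (G.restrict F).toSimpleGraph) u

lemma Joined.symm {F : Set E} {u v : G.vertexSet} (h : Joined G F u v) : Joined G F v u :=
  SimpleGraph.Reachable.symm h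

lemma Joined.trans {F : Set E} {u v w : G.vertexSet} (h : Joined G F u v) (h' : Joined G F v w) :
    Joined G F u w :=
  SimpleGraph.Reachable.trans h h'

lemma joined_of_isLink {F : Set E} {e : E} {u v : G.vertexSet} (he : e ∈ F)
    (h : G.IsLink e u v) : Joined G F u v := by
  by_cases huv : u = v
  · subst huv; exact Joined.refl u
  · exact SimpleGraph.Adj.reachable (G := (G.restrict F).toSimpleGraph) (u := u) (v := v)
      ⟨huv, e, he, h⟩

/-- `Joined G F` is the least equivalence relation that relates the ends of each edge of `F`. -/
lemma Joined.elim {F : Set E} {R : G.vertexSet → G.vertexSet → Prop} (hR : Equivalence R)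
    (hF : ∀ e ∈ F, ∀ u v : G.vertexSet, G.IsLink e u v → R u v) {u v : G.vertexSet}
    (h : Joined G F u v) : R u v := by
  obtain ⟨w⟩ := h
  induction w with
  | nil => exact hR.refl _
  | cons hadj _ ih =>
    obtain ⟨-, e, he, hl⟩ := hadj
    exact hR.trans (hF e he _ _ hl) ih

lemma joined_equivalence (F : Set E) : Equivalence (Joined G F) :=
  ⟨Joined.refl, Joined.symm, Joined.trans⟩

lemma Joined.mono {F F' : Set E} (hF : F ⊆ F') {u v : G.vertexSet} (h : Joined G F u v) :
    Joined G F' u v :=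
  h.elim (joined_equivalence F') fun _ he _ _ hl => joined_of_isLink (hF he) hl

lemma numContracted_eq (G : Graph V E) (F : Set E) :
    numContracted G F = Nat.card (Quot (Joined G F)) := rfl

lemma quot_joined_eq {F : Set E} {u v : G.vertexSet} :
    Quot.mk (Joined G F) u = Quot.mk (Joined G F) v ↔ Joined G F u v :=
  (joined_equivalence F).quot_mk_eq_iff u v

/-- The surjection between the sets of components induced by an inclusion of connectivity
relations. -/
def componentMap {F F' : Set E} (h : ∀ u v, Joined G F u v → Joined G F' u v) :
    Quot (Joined G F) → Quot (Joined G F') :=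
  Quot.map id h

lemma componentMap_surjective {F F' : Set E} (h : ∀ u v, Joined G F u v → Joined G F' u v) :
    Function.Surjective (componentMap h) := by
  rintro ⟨v⟩
  exact ⟨Quot.mk _ v, rfl⟩

lemma numContracted_empty : numContracted G (∅ : Set E) = G.vertexSet.ncard := by
  rw [numContracted_eq, ← Nat.card_coe_set_eq]
  refine (Nat.card_congr (Equiv.ofBijective (Quot.mk (Joined G ∅)) ⟨?_, Quot.mk_surjective⟩)).symm
  intro u v h
  exact (quot_joined_eq.1 h).elim eq_equivalence fun e he => absurd he (Set.notMem_empty e)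

lemma numContracted_eq_one_iff_connected {F : Set E} :
    numContracted G F = 1 ↔ (G.restrict F).toSimpleGraph.Connected := by
  rw [numContracted_eq, Nat.card_eq_one_iff_unique]
  constructor
  · rintro ⟨hs, ⟨⟨v⟩⟩⟩
    have : Nonempty (G.restrict F).vertexSet := ⟨v⟩
    exact ⟨fun u v => quot_joined_eq.1 (hs.elim (Quot.mk (Joined G F) u) (Quot.mk _ v))⟩
  · intro h
    refine ⟨⟨?_⟩, ⟨Quot.mk _ h.nonempty.some⟩⟩
    rintro ⟨u⟩ ⟨v⟩
    exact quot_joined_eq.2 (h.preconnected u v)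

lemma IsSpanningTree.numContracted_eq_one {T : Finset E} (hT : IsSpanningTree G T) :
    numContracted G (T : Set E) = 1 :=
  numContracted_eq_one_iff_connected.2 hT.2.1

variable [Finite V]

lemma numContracted_le_of_joined {F F' : Set E} (h : ∀ u v, Joined G F u v → Joined G F' u v) :
    numContracted G F' ≤ numContracted G F :=
  Nat.card_le_card_of_surjective _ (componentMap_surjective h)

lemma numContracted_anti {F F' : Set E} (h : F ⊆ F') : numContracted G F' ≤ numContracted G F :=
  numContracted_le_of_joined fun _ _ => Joined.mono h

/-- If enlarging `F` to `F'` does not reduce the number of components, then both sets have the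
same components. -/
lemma joined_of_numContracted_le {F F' : Set E} (h : F ⊆ F')
    (hn : numContracted G F ≤ numContracted G F') {u v : G.vertexSet} (huv : Joined G F' u v) :
    Joined G F u v := by
  have hinj := ((Nat.bijective_iff_surjective_and_card (componentMap fun _ _ => Joined.mono h)).2
    ⟨componentMap_surjective (G := G) fun _ _ => Joined.mono h,
      le_antisymm hn (numContracted_anti h)⟩).1
  exact quot_joined_eq.1 (hinj (a₁ := Quot.mk _ u) (a₂ := Quot.mk _ v) (quot_joined_eq.2 huv))

lemma numContracted_le_ncard (F : Set E) : numContracted G F ≤ G.vertexSet.ncard :=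
  numContracted_empty (G := G) ▸ numContracted_anti (Set.empty_subset F)

lemma numContracted_pos (hG : G.vertexSet.Nonempty) (F : Set E) : 0 < numContracted G F := by
  obtain ⟨v, hv⟩ := hG
  have : Nonempty (Quot (Joined G F)) := ⟨Quot.mk _ ⟨v, hv⟩⟩
  rw [numContracted_eq]
  exact Nat.card_pos

/-- One additional edge merges at most two components. -/
lemma numContracted_le_insert (F : Set E) (e : E) :
    numContracted G F ≤ numContracted G (insert e F) + 1 := by
  classical
  by_cases he : ∃ x y : G.vertexSet, G.IsLink e x y
  · obtain ⟨x, y, hxy⟩ := he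
    -- Send the component of `x` to `none` and every other component to the one containing it.
    let g : Quot (Joined G F) → Option (Quot (Joined G (insert e F))) := fun c =>
      if c = Quot.mk _ x then none
      else some (componentMap (fun _ _ => Joined.mono (Set.subset_insert e F)) c)
    have hg : Function.Injective g := by
      rintro ⟨u⟩ ⟨v⟩ h
      by_cases hu : Quot.mk (Joined G F) u = Quot.mk _ x <;>
        by_cases hv : Quot.mk (Joined G F) v = Quot.mk _ x
      · exact hu.trans hv.symm
      · simp [g, hu, hv] at h
      · simp [g, hu, hv] at h
      · simp only [g, hu, hv, if_false, Option.some.injEq] at h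
        have h' : Joined G (insert e F) u v := quot_joined_eq.1 h
        rw [quot_joined_eq] at hu hv ⊢
        have key : Joined G F u v ∨ ((Joined G F u x ∨ Joined G F u y) ∧
            (Joined G F v x ∨ Joined G F v y)) := by
          refine h'.elim (R := fun u v => Joined G F u v ∨ ((Joined G F u x ∨ Joined G F u y) ∧
            (Joined G F v x ∨ Joined G F v y))) ⟨fun u => Or.inl (Joined.refl u), ?_, ?_⟩ ?_
          · rintro a b (h | ⟨h, h'⟩)
            · exact Or.inl h.symm
            · exact Or.inr ⟨h', h⟩
          · rintro a b c (h | ⟨h1, h2⟩) (h' | ⟨h3, h4⟩)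
            · exact Or.inl (h.trans h')
            · exact Or.inr ⟨h3.imp h.trans h.trans, h4⟩
            · exact Or.inr ⟨h1, h2.imp h'.symm.trans h'.symm.trans⟩
            · exact Or.inr ⟨h1, h4⟩
          · rintro f (rfl | hf) a b hab
            · rcases hxy.eq_and_eq_or_eq_and_eq hab with ⟨h1, h2⟩ | ⟨h1, h2⟩
              · rw [← Subtype.ext h1, ← Subtype.ext h2]
                exact Or.inr ⟨Or.inl (Joined.refl x), Or.inr (Joined.refl y)⟩
              · rw [← Subtype.ext h1, ← Subtype.ext h2]
                exact Or.inr ⟨Or.inr (Joined.refl y), Or.inl (Joined.refl x)⟩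
            · exact Or.inl (joined_of_isLink hf hab)
        rcases key with h | ⟨h1, h2⟩
        · exact h
        · exact (h1.resolve_left hu).trans (h2.resolve_left hv).symm
    calc numContracted G F ≤ Nat.card (Option (Quot (Joined G (insert e F)))) :=
          Nat.card_le_card_of_injective g hg
      _ = numContracted G (insert e F) + 1 := Finite.card_option
  · refine (numContracted_le_of_joined fun u v h => h.elim (joined_equivalence F) ?_).trans
      (Nat.le_succ _)
    rintro f (rfl | hf) a b hab
    · exact absurd ⟨a, b, hab⟩ he
    · exact joined_of_isLink hf hab

lemma numContracted_le_union_card (F : Set E) (S : Finset E) :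
    numContracted G F ≤ numContracted G (F ∪ S) + S.card := by
  classical
  induction S using Finset.induction_on with
  | empty => simp
  | insert e S he ih =>
    rw [Finset.card_insert_of_notMem he, Finset.coe_insert, Set.union_insert]
    have := numContracted_le_insert (G := G) (F ∪ S) e
    omega

/-- A subset of a spanning tree is acyclic: each of its edges reduces the number of components. -/
lemma IsSpanningTree.numContracted_add_card {T S : Finset E} (hT : IsSpanningTree G T)
    (hS : S ⊆ T) : numContracted G (S : Set E) + S.card = G.vertexSet.ncard := by
  classical
  have h1 := numContracted_le_union_card (G := G) ∅ S
  have h2 := numContracted_le_union_card (G := G) S (T \ S)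
  rw [Set.empty_union, numContracted_empty] at h1
  rw [← Finset.coe_union, Finset.union_sdiff_of_subset hS, hT.numContracted_eq_one,
    Finset.card_sdiff_of_subset hS] at h2
  have h3 := hT.2.2
  have h4 := Finset.card_le_card hS
  omega

/-- The components of `F ∪ A` are determined by those of `F`. -/
lemma numContracted_union_eq {S F : Set E} (h : S ⊆ F)
    (hn : numContracted G F = numContracted G S) (A : Set E) :
    numContracted G (S ∪ A) = numContracted G (F ∪ A) := by
  refine le_antisymm (numContracted_le_of_joined fun u v huv => ?_)
    (numContracted_anti (Set.union_subset_union_left A h))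
  refine huv.elim (joined_equivalence _) ?_
  rintro e (he | he) a b hab
  · exact (joined_of_numContracted_le h hn.ge (joined_of_isLink he hab)).mono
      Set.subset_union_left
  · exact joined_of_isLink (Or.inr he) hab

open Classical in
/-- `T` is tight for `F` if `T ∩ F` has the same components as `F`, that is, `T` contains a
spanning forest of `F`. -/
def IsTight (G : Graph V E) (T : Finset E) (F : Set E) : Prop :=
  numContracted G ({e ∈ T | e ∈ F} : Finset E) = numContracted G F

open Classical in
lemma IsSpanningTree.card_filter_of_isTight {T : Finset E} (hT : IsSpanningTree G T) {F : Set E}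
    (hF : IsTight G T F) :
    {e ∈ T | e ∈ F}.card + numContracted G F = G.vertexSet.ncard := by
  rw [← hF, add_comm]
  exact hT.numContracted_add_card (Finset.filter_subset _ _)

open Classical in
lemma IsSpanningTree.card_filter_notMem_of_isTight {T : Finset E} (hT : IsSpanningTree G T)
    {F : Set E} (hF : IsTight G T F) : {e ∈ T | e ∉ F}.card + 1 = numContracted G F := by
  have h1 := hT.card_filter_of_isTight hF
  have h2 := hT.2.2
  have h3 := Finset.card_filter_add_card_filter_not (s := T) (fun e => e ∈ F)
  omega

open Classical in
/-- The matroid inequality behind all comparisons of trees: in the contraction of `W`, the tree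
`T` leaves an independent set in `A`, whereas `T'` leaves a spanning set of `A`. -/
lemma card_filter_le_of_isTight {T T' : Finset E} (hT : IsSpanningTree G T) {A W : Set E}
    (hW : IsTight G T W) (hA : IsTight G T' A) :
    {e ∈ T | e ∈ A ∧ e ∉ W}.card ≤ {e ∈ T' | e ∈ A ∧ e ∉ W}.card := by
  have h1 := hT.card_filter_of_isTight hW
  have h2 : {e ∈ T | e ∈ A ∪ W}.card = {e ∈ T | e ∈ W}.card + {e ∈ T | e ∈ A ∧ e ∉ W}.card := by
    rw [← Finset.card_union_of_disjoint]
    · congr 1; ext e; simp; tauto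
    · rw [Finset.disjoint_filter]; tauto
  have h3 : numContracted G ({e ∈ T | e ∈ A ∪ W} : Finset E) + {e ∈ T | e ∈ A ∪ W}.card =
      G.vertexSet.ncard := hT.numContracted_add_card (Finset.filter_subset _ _)
  have h4 : numContracted G (A ∪ W) ≤ numContracted G ({e ∈ T | e ∈ A ∪ W} : Finset E) :=
    numContracted_anti fun e he => by simp at he ⊢; exact he.2
  have h5 := numContracted_le_union_card (G := G) W {e ∈ T' | e ∈ A ∧ e ∉ W}
  have h6 : numContracted G (W ∪ ({e ∈ T' | e ∈ A ∧ e ∉ W} : Finset E)) =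
      numContracted G (A ∪ W) := by
    rw [← numContracted_union_eq (S := ({e ∈ T' | e ∈ A} : Finset E)) (F := A)
      (fun e he => by simp at he; exact he.2) hA.symm W]
    congr 1; ext e; simp; tauto
  omega

/-- An acyclic edge set extends to a spanning tree within any connected set that contains it. -/
lemma exists_isSpanningTree_between {S U : Finset E} (hSU : S ⊆ U) (hU : (U : Set E) ⊆ G.edgeSet)
    (hS : numContracted G (S : Set E) + S.card = G.vertexSet.ncard)
    (hU1 : numContracted G (U : Set E) = 1) :
    ∃ B, S ⊆ B ∧ B ⊆ U ∧ IsSpanningTree G B := by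
  classical
  obtain ⟨B, hB, hmax⟩ := Finset.exists_max_image
    (U.powerset.filter fun B => S ⊆ B ∧ numContracted G (B : Set E) + B.card = G.vertexSet.ncard)
    Finset.card ⟨S, by simp [hSU, hS]⟩
  simp only [Finset.mem_filter, Finset.mem_powerset] at hB hmax
  obtain ⟨hBU, hSB, hBn⟩ := hB
  have hU' : ∀ u v, Joined G (U : Set E) u v → Joined G (B : Set E) u v := by
    intro u v huv
    refine huv.elim (joined_equivalence _) fun e he a b hab => ?_
    by_contra hnot
    have heB : e ∉ B := fun h => hnot (joined_of_isLink (by simpa using h) hab)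
    have h1 : numContracted G (insert e (B : Set E)) < numContracted G (B : Set E) := by
      by_contra hlt
      exact hnot (joined_of_numContracted_le (Set.subset_insert e _) (not_lt.1 hlt)
        (joined_of_isLink (Set.mem_insert e _) hab))
    have h2 := numContracted_le_insert (G := G) (B : Set E) e
    have h3 := hmax (insert e B) ⟨Finset.insert_subset he hBU, hSB.trans (Finset.subset_insert e B),
      by rw [Finset.card_insert_of_notMem heB, Finset.coe_insert]; omega⟩
    rw [Finset.card_insert_of_notMem heB] at h3
    omega
  have hB1 : numContracted G (B : Set E) = 1 :=
    le_antisymm ((numContracted_le_of_joined hU').trans hU1.le)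
      (hU1 ▸ numContracted_anti (Finset.coe_subset.2 hBU))
  refine ⟨B, hSB, hBU, (Finset.coe_subset.2 hBU).trans hU,
    numContracted_eq_one_iff_connected.1 hB1, ?_⟩
  omega

/-- Kruskal's criterion: a minimum spanning tree contains a spanning forest of every set `W` of
edges that are lighter than all others. -/
lemma IsMinSpanningTree.isTight {w : E → ℝ} {T : Finset E} (hT : IsMinSpanningTree G w T)
    {W : Set E} (hW : ∀ e ∈ W, ∀ f ∉ W, w e < w f) : IsTight G T W := by
  classical
  set S : Finset E := {e ∈ T | e ∈ W} with hS
  have hSW : (S : Set E) ⊆ W := fun e he => by simp [hS] at he; exact he.2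
  refine le_antisymm (numContracted_le_of_joined fun u v huv => ?_) (numContracted_anti hSW)
  refine huv.elim (joined_equivalence _) fun f hf a b hab => ?_
  by_contra hnot
  have hfS : f ∉ S := fun h => hnot (joined_of_isLink (Finset.mem_coe.2 h) hab)
  have hfT : f ∉ T := fun h => hfS (by simp [hS, h, hf])
  have h1 : numContracted G (insert f (S : Set E)) < numContracted G (S : Set E) := by
    by_contra hlt
    exact hnot (joined_of_numContracted_le (Set.subset_insert f _) (not_lt.1 hlt)
      (joined_of_isLink (Set.mem_insert f _) hab))
  have h2 := numContracted_le_insert (G := G) (S : Set E) f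
  have h3 := hT.1.numContracted_add_card (Finset.filter_subset (· ∈ W) T)
  rw [← hS] at h3
  have hpos := numContracted_pos (G := G) ⟨a, a.2⟩ (insert f (T : Set E))
  -- Exchange an edge outside `W` for `f`.
  obtain ⟨B, hSB, hBU, hB⟩ := exists_isSpanningTree_between (G := G) (S := insert f S)
    (U := insert f T) (Finset.insert_subset_insert f (Finset.filter_subset _ _))
    (by
      rw [Finset.coe_insert]
      exact Set.insert_subset hab.edge_mem hT.1.1)
    (by rw [Finset.card_insert_of_notMem hfS, Finset.coe_insert]; omega)
    (by
      have := numContracted_anti (G := G) (Set.subset_insert f (T : Set E))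
      rw [hT.1.numContracted_eq_one] at this
      rw [Finset.coe_insert]; omega)
  have hcard : (insert f T \ B).card = 1 := by
    have h4 := hB.2.2
    have h5 := hT.1.2.2
    rw [Finset.card_sdiff_of_subset hBU, Finset.card_insert_of_notMem hfT]
    omega
  obtain ⟨g, hg⟩ := Finset.card_eq_one.1 hcard
  have hgm : g ∈ insert f T \ B := by rw [hg]; exact Finset.mem_singleton_self g
  rw [Finset.mem_sdiff] at hgm
  have hgW : g ∉ W := by
    intro hgW
    refine hgm.2 (hSB ?_)
    rcases Finset.mem_insert.1 hgm.1 with h | h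
    · exact Finset.mem_insert.2 (Or.inl h)
    · exact Finset.mem_insert.2 (Or.inr (by simp [hS, h, hgW]))
  have hsum := Finset.sum_sdiff (f := w) hBU
  rw [hg, Finset.sum_singleton, Finset.sum_insert hfT] at hsum
  have := hT.2 B hB
  have := hW f hf g hgW
  linarith

end Connectivity

/-! ### Ideal loads -/

section Ideal

open Classical in
/-- The loads induced by a weight function `μ` on the edge sets: `∑_{T ∋ e} μ(T)`. -/
noncomputable def mixedLoad {E : Type*} (𝒮 : Finset (Finset E)) (μ : Finset E → ℝ) (e : E) : ℝ :=
  ∑ T ∈ 𝒮, if e ∈ T then μ T else 0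

lemma mixedLoad_nonneg {E : Type*} {𝒮 : Finset (Finset E)} {μ : Finset E → ℝ}
    (hμ : ∀ T ∈ 𝒮, 0 ≤ μ T) (e : E) : 0 ≤ mixedLoad 𝒮 μ e :=
  Finset.sum_nonneg fun T hT => by split_ifs <;> simp [hμ T hT]

open Classical in
/-- Double counting: a weighted sum of the mixed loads is the average of the sums over the
members of the family. -/
lemma sum_mixedLoad_mul {E : Type*} (𝒮 : Finset (Finset E)) (μ : Finset E → ℝ) (S : Finset E)
    (f : E → ℝ) :
    ∑ e ∈ S, mixedLoad 𝒮 μ e * f e = ∑ T ∈ 𝒮, μ T * ∑ e ∈ T with e ∈ S, f e := by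
  simp_rw [mixedLoad, Finset.sum_mul, Finset.mul_sum]
  rw [Finset.sum_comm]
  refine Finset.sum_congr rfl fun T _ => ?_
  have : T.filter (· ∈ S) = S.filter (· ∈ T) := by ext; simp [and_comm]
  rw [this, Finset.sum_filter]
  exact Finset.sum_congr rfl fun e _ => by split_ifs <;> simp

/-- The ideal distribution: the point of least Euclidean norm in the convex hull of a family of
edge sets is an average of members of the family that have minimum weight with respect to it. -/
lemma exists_ideal_distribution {E : Type*} [Fintype E] {𝒮 : Finset (Finset E)}
    (h𝒮 : 𝒮.Nonempty) :
    ∃ μ : Finset E → ℝ, (∀ T ∈ 𝒮, 0 ≤ μ T) ∧ ∑ T ∈ 𝒮, μ T = 1 ∧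
      ∀ T ∈ 𝒮, μ T ≠ 0 → ∀ T' ∈ 𝒮,
        ∑ e ∈ T, mixedLoad 𝒮 μ e ≤ ∑ e ∈ T', mixedLoad 𝒮 μ e := by
  classical
  set K : Set (Finset E → ℝ) := {μ | μ ∈ stdSimplex ℝ (Finset E) ∧ ∀ T ∉ 𝒮, μ T = 0} with hK
  have hsum : ∀ μ ∈ K, ∑ T ∈ 𝒮, μ T = 1 := fun μ hμ => by
    rw [← hμ.1.2]
    exact Finset.sum_subset (Finset.subset_univ _) fun T _ hT => hμ.2 T hT
  have hKc : IsCompact K := by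
    refine (isCompact_stdSimplex ℝ (Finset E)).inter_right
      (t := {μ : Finset E → ℝ | ∀ T ∉ 𝒮, μ T = 0}) ?_
    simp only [Set.ofPred_forall]
    exact isClosed_iInter fun T => isClosed_iInter fun _ =>
      isClosed_eq (continuous_apply T) continuous_const
  have hvertex : ∀ T ∈ 𝒮, (Pi.single T 1 : Finset E → ℝ) ∈ K := fun T hT =>
    ⟨single_mem_stdSimplex ℝ T, fun T' hT' =>
      Pi.single_eq_of_ne (by rintro rfl; exact hT' hT) _⟩
  have hconv : Convex ℝ K := by
    rintro a ⟨ha, ha'⟩ b ⟨hb, hb'⟩ s t hs ht hst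
    exact ⟨convex_stdSimplex ℝ _ ha hb hs ht hst, fun T hT => by simp [ha' T hT, hb' T hT]⟩
  have hcont : Continuous fun μ : Finset E → ℝ => ∑ e, mixedLoad 𝒮 μ e ^ 2 := by
    unfold mixedLoad
    refine continuous_finsetSum _ fun e _ => (continuous_finsetSum _ fun T _ => ?_).pow 2
    split_ifs
    · exact continuous_apply T
    · exact continuous_const
  obtain ⟨T₀, hT₀⟩ := h𝒮
  obtain ⟨μ, hμ, hmin⟩ := hKc.exists_isMinOn ⟨_, hvertex T₀ hT₀⟩ hcont.continuousOn
  have hlin : ∀ ν ν' : Finset E → ℝ, ∀ s t : ℝ, ∀ e,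
      mixedLoad 𝒮 (s • ν + t • ν') e = s * mixedLoad 𝒮 ν e + t * mixedLoad 𝒮 ν' e := by
    intro ν ν' s t e
    simp only [mixedLoad, Finset.mul_sum, ← Finset.sum_add_distrib]
    exact Finset.sum_congr rfl fun T _ => by split_ifs <;> simp
  have hsingle : ∀ T ∈ 𝒮, ∀ e, mixedLoad 𝒮 (Pi.single T 1) e = if e ∈ T then 1 else 0 := by
    intro T hT e
    rw [mixedLoad, Finset.sum_eq_single_of_mem T hT]
    · simp
    · intro T' _ hne
      simp [Pi.single_eq_of_ne hne]
  set x := mixedLoad 𝒮 μ with hx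
  -- First-order optimality in the direction of the vertex `T`.
  have hopt : ∀ T ∈ 𝒮, ∑ e, x e * x e ≤ ∑ e ∈ T, x e := by
    intro T hT
    set d : E → ℝ := fun e => (if e ∈ T then 1 else 0) - x e with hd
    have hquad : ∀ h : ℝ, 0 < h → h ≤ 1 → 0 ≤ 2 * ∑ e, x e * d e + h * ∑ e, d e ^ 2 := by
      intro h h0 h1
      have hm := hmin (hconv hμ (hvertex T hT) (sub_nonneg.2 h1) h0.le (by ring))
      simp only [Set.mem_ofPred_eq] at hm
      have heq : ∑ e, mixedLoad 𝒮 ((1 - h) • μ + h • Pi.single T 1) e ^ 2 =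
          ∑ e, x e ^ 2 + h * (2 * ∑ e, x e * d e + h * ∑ e, d e ^ 2) := by
        simp only [Finset.mul_sum, ← Finset.sum_add_distrib]
        refine Finset.sum_congr rfl fun e _ => ?_
        rw [hlin, hsingle T hT, hd]
        ring
      rw [heq] at hm
      exact nonneg_of_mul_nonneg_right (by linarith) h0
    have hd0 : 0 ≤ ∑ e, x e * d e := by
      by_contra hneg
      push Not at hneg
      have hD : 0 ≤ ∑ e, d e ^ 2 := Finset.sum_nonneg fun e _ => sq_nonneg _
      set a := ∑ e, x e * d e
      set D := ∑ e, d e ^ 2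
      -- A step of this length makes the quadratic negative.
      have hpos : 0 < -a / (D - a) := div_pos (by linarith) (by linarith)
      have hle : -a / (D - a) ≤ 1 := (div_le_one (by linarith)).2 (by linarith)
      have := hquad _ hpos hle
      have h2 : -a / (D - a) * D ≤ -a := by
        rw [div_mul_eq_mul_div, div_le_iff₀ (by linarith)]
        nlinarith
      linarith
    have : ∑ e, x e * d e = ∑ e ∈ T, x e - ∑ e, x e * x e := by
      simp only [hd, mul_sub, Finset.sum_sub_distrib, mul_ite, mul_one, mul_zero]
      rw [Finset.sum_ite_mem, Finset.univ_inter]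
    linarith
  have havg : ∑ e, x e * x e = ∑ T ∈ 𝒮, μ T * ∑ e ∈ T, x e := by
    rw [hx, sum_mixedLoad_mul]
    simp
  refine ⟨μ, fun T _ => hμ.1.1 T, hsum μ hμ, fun T hT hne T' hT' => ?_⟩
  refine le_trans (le_of_eq ?_) (hopt T' hT')
  have hz : ∑ T ∈ 𝒮, μ T * (∑ e ∈ T, x e - ∑ e, x e * x e) = 0 := by
    simp only [mul_sub, Finset.sum_sub_distrib, ← Finset.sum_mul, hsum μ hμ, one_mul]
    linarith
  have := (Finset.sum_eq_zero_iff_of_nonneg fun T hT =>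
    mul_nonneg (hμ.1.1 T) (sub_nonneg.2 (hopt T hT))).1 hz T hT
  rcases mul_eq_zero.1 this with h | h
  · exact absurd h hne
  · linarith

end Ideal

/-! ### Convergence of greedy tree packings -/

section Greedy

/-- A nonnegative function has the smaller sum over `P` if each of its superlevel sets has fewer
elements in `P` than in `Q`. -/
lemma sum_le_sum_of_card_superlevel_le {E : Type*} {f : E → ℝ} (hf : ∀ e, 0 ≤ f e)
    (P Q : Finset E) (h : ∀ r, {e ∈ P | r ≤ f e}.card ≤ {e ∈ Q | r ≤ f e}.card) :
    ∑ e ∈ P, f e ≤ ∑ e ∈ Q, f e := by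
  classical
  induction hn : P.card generalizing P Q with
  | zero =>
    rw [Finset.card_eq_zero.1 hn, Finset.sum_empty]
    exact Finset.sum_nonneg fun e _ => hf e
  | succ k ih =>
    obtain ⟨p, hp, hpmax⟩ := Finset.exists_max_image P f (Finset.card_pos.1 (by omega))
    have hQp : {e ∈ Q | f p ≤ f e}.Nonempty :=
      Finset.card_pos.1 ((Finset.card_pos.2 ⟨p, by simp [hp]⟩).trans_le (h (f p)))
    obtain ⟨q, hq⟩ := hQp
    rw [Finset.mem_filter] at hq
    have key := ih (P.erase p) (Q.erase q) (fun r => ?_)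
      (by rw [Finset.card_erase_of_mem hp, hn]; rfl)
    · rw [← Finset.add_sum_erase P f hp, ← Finset.add_sum_erase Q f hq.1]
      linarith [hq.2]
    · rw [Finset.filter_erase, Finset.filter_erase]
      rcases le_or_gt r (f p) with hr | hr
      · rw [Finset.card_erase_of_mem (by simp [hp, hr]),
          Finset.card_erase_of_mem (by simp [hq.1, hr.trans hq.2])]
        exact Nat.sub_le_sub_right (h r) 1
      · rw [Finset.filter_false_of_mem fun e he => not_le.2 ((hpmax e he).trans_lt hr)]
        simp

variable {V E : Type*} {G : Graph V E} [Finite V]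

open Classical in
lemma sum_filter_le_of_isTight {T T' : Finset E} (hT : IsSpanningTree G T) {A : Set E}
    (hA : IsTight G T' A) {f : E → ℝ} (hf : ∀ e, 0 ≤ f e)
    (hW : ∀ r, IsTight G T {e | f e < r}) :
    ∑ e ∈ T with e ∈ A, f e ≤ ∑ e ∈ T' with e ∈ A, f e := by
  refine sum_le_sum_of_card_superlevel_le hf _ _ fun r => ?_
  have := card_filter_le_of_isTight hT (hW r) hA
  simpa only [Finset.filter_filter, Set.mem_ofPred_eq, not_lt] using this

open Classical in
lemma sum_filter_notMem_le_of_isTight {T T' : Finset E} (hT' : IsSpanningTree G T') {A : Set E}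
    (hA : IsTight G T' A) {f : E → ℝ} (hf : ∀ e, 0 ≤ f e)
    (hW : ∀ r, IsTight G T {e | r ≤ f e}) :
    ∑ e ∈ T' with e ∉ A, f e ≤ ∑ e ∈ T with e ∉ A, f e := by
  refine sum_le_sum_of_card_superlevel_le hf _ _ fun r => ?_
  have := card_filter_le_of_isTight hT' hA (hW r)
  simpa only [Finset.filter_filter, Set.mem_ofPred_eq, and_comm] using this

open Classical in
/-- The number of the trees `T 0, …, T (t - 1)` that contain `e`. -/
noncomputable def useCount {E : Type*} (T : ℕ → Finset E) (t : ℕ) (e : E) : ℕ :=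
  {i ∈ Finset.range t | e ∈ T i}.card

lemma load_range {E : Type*} (T : ℕ → Finset E) (t : ℕ) (e : E) :
    load T (Finset.range t) e = useCount T t e / t := by
  simp only [load, useCount, Finset.card_range]

open Classical in
lemma useCount_succ {E : Type*} (T : ℕ → Finset E) (t : ℕ) (e : E) :
    useCount T (t + 1) e = useCount T t e + if e ∈ T t then 1 else 0 := by
  rw [useCount, useCount, Finset.range_add_one, Finset.filter_insert]
  split_ifs
  · rw [Finset.card_insert_of_notMem (by simp)]
  · rfl

lemma useCount_lt_of_load_lt {E : Type*} {T : ℕ → Finset E} {t : ℕ} {e f : E}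
    (h : useCount T t e < useCount T t f) :
    load T (Finset.range t) e < load T (Finset.range t) f := by
  rcases Nat.eq_zero_or_pos t with rfl | ht
  · simp [useCount] at h
  · rw [load_range, load_range]
    have : (0 : ℝ) < t := by exact_mod_cast ht
    gcongr

open Classical in
/-- Multiplicative growth of the exponential potential `∑_{e ∈ S} exp(s L_e)`, for either sign
of `s`. -/
lemma sum_exp_useCount_le {E : Type*} (T : ℕ → Finset E) (S : Finset E) (s θ : ℝ) (N : ℕ)
    (h : ∀ i < N, (Real.exp s - 1) * ∑ e ∈ T i with e ∈ S, Real.exp (s * useCount T i e) ≤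
      (Real.exp s - 1) * (θ * ∑ e ∈ S, Real.exp (s * useCount T i e))) (t : ℕ) (ht : t ≤ N) :
    ∑ e ∈ S, Real.exp (s * useCount T t e) ≤ S.card * Real.exp ((Real.exp s - 1) * θ * t) := by
  induction t with
  | zero => simp [useCount]
  | succ t ih =>
    have hstep : ∑ e ∈ S, Real.exp (s * useCount T (t + 1) e) =
        ∑ e ∈ S, Real.exp (s * useCount T t e) +
          (Real.exp s - 1) * ∑ e ∈ T t with e ∈ S, Real.exp (s * useCount T t e) := by
      have : (T t).filter (· ∈ S) = S.filter (· ∈ T t) := by ext; simp [and_comm]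
      rw [this, Finset.sum_filter, Finset.mul_sum, ← Finset.sum_add_distrib]
      refine Finset.sum_congr rfl fun e _ => ?_
      rw [useCount_succ]
      split_ifs
      · push_cast
        rw [mul_add, mul_one, Real.exp_add]; ring
      · simp
    have hΦ : 0 ≤ ∑ e ∈ S, Real.exp (s * useCount T t e) :=
      Finset.sum_nonneg fun e _ => (Real.exp_pos _).le
    calc ∑ e ∈ S, Real.exp (s * useCount T (t + 1) e)
        ≤ (1 + (Real.exp s - 1) * θ) * ∑ e ∈ S, Real.exp (s * useCount T t e) := by
          rw [hstep]; linarith [h t (by omega)]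
      _ ≤ Real.exp ((Real.exp s - 1) * θ) * ∑ e ∈ S, Real.exp (s * useCount T t e) := by
          gcongr
          linarith [Real.add_one_le_exp ((Real.exp s - 1) * θ)]
      _ ≤ Real.exp ((Real.exp s - 1) * θ) *
            (S.card * Real.exp ((Real.exp s - 1) * θ * t)) := by
          gcongr; exact ih (by omega)
      _ = S.card * Real.exp ((Real.exp s - 1) * θ * (t + 1 : ℕ)) := by
          push_cast
          rw [mul_add, mul_one, Real.exp_add]; ring

open Classical in
lemma mul_useCount_le {E : Type*} {T : ℕ → Finset E} {S : Finset E} {s θ : ℝ} {N m : ℕ}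
    (hs : |s| ≤ 1) (hθ : 0 ≤ θ)
    (h : ∀ i < N, (Real.exp s - 1) * ∑ e ∈ T i with e ∈ S, Real.exp (s * useCount T i e) ≤
      (Real.exp s - 1) * (θ * ∑ e ∈ S, Real.exp (s * useCount T i e))) {t : ℕ} (ht : t ≤ N)
    (hm : S.card ≤ m) {e : E} (he : e ∈ S) :
    s * useCount T t e ≤ Real.log m + (s + s ^ 2) * θ * t := by
  have h1 : Real.exp (s * useCount T t e) ≤ S.card * Real.exp ((Real.exp s - 1) * θ * t) :=
    (Finset.single_le_sum (f := fun e => Real.exp (s * useCount T t e))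
      (fun e _ => (Real.exp_pos _).le) he).trans (sum_exp_useCount_le T S s θ N h t ht)
  have hm0 : (0 : ℝ) < m := by exact_mod_cast (Finset.card_pos.2 ⟨e, he⟩).trans_le hm
  have h2 : Real.exp s - 1 ≤ s + s ^ 2 := by
    have := Real.abs_exp_sub_one_sub_id_le hs
    linarith [(abs_le.1 this).2]
  have h3 : Real.exp (s * useCount T t e) ≤ Real.exp (Real.log m + (s + s ^ 2) * θ * t) := by
    rw [Real.exp_add, Real.exp_log hm0]
    refine h1.trans ?_
    gcongr
  exact Real.exp_le_exp.1 h3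

open Classical in
/-- The greedy tree packing converges to the ideal loads, uniformly over the edges. -/
lemma abs_load_sub_mixedLoad_le [Finite E] {N m : ℕ} {T : ℕ → Finset E}
    (hT : IsGreedyTreePacking G N T) {𝒮 : Finset (Finset E)} (h𝒮 : ∀ T ∈ 𝒮, IsSpanningTree G T)
    {μ : Finset E → ℝ} (hμ : ∀ T ∈ 𝒮, 0 ≤ μ T) (hμ1 : ∑ T ∈ 𝒮, μ T = 1)
    (hmin : ∀ T ∈ 𝒮, μ T ≠ 0 → IsMinSpanningTree G (mixedLoad 𝒮 μ) T)
    (hm : G.edgeSet.ncard ≤ m) {ε : ℝ} (hε : 0 < ε) (hε1 : ε ≤ 1) {t : ℕ} (ht0 : 0 < t)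
    (ht : t ≤ N) {e : E} (he : e ∈ G.edgeSet) :
    |load T (Finset.range t) e - mixedLoad 𝒮 μ e| ≤
      Real.log m / (ε * t) + ε * mixedLoad 𝒮 μ e := by
  have := Fintype.ofFinite E
  set x := mixedLoad 𝒮 μ with hx
  have hx0 : ∀ e, 0 ≤ x e := mixedLoad_nonneg hμ
  have ht0' : (0 : ℝ) < t := by exact_mod_cast ht0
  have hcard : ∀ S : Finset E, (∀ e ∈ S, e ∈ G.edgeSet) → S.card ≤ m := fun S hS => by
    refine le_trans ?_ hm
    rw [← Set.ncard_coe_finset]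
    exact Set.ncard_le_ncard hS (Set.toFinite _)
  -- Sums over `S` weighted by the ideal loads are averages over the supporting trees.
  have havg_le : ∀ (S : Finset E) (f : E → ℝ) (b : ℝ), (∀ T ∈ 𝒮, μ T ≠ 0 →
      b ≤ ∑ e ∈ T with e ∈ S, f e) → b ≤ ∑ e ∈ S, x e * f e := by
    intro S f b hb
    rw [hx, sum_mixedLoad_mul, ← one_mul b, ← hμ1, Finset.sum_mul]
    refine Finset.sum_le_sum fun T hT => ?_
    by_cases h0 : μ T = 0
    · simp [h0]
    · exact mul_le_mul_of_nonneg_left (hb T hT h0) (hμ T hT)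
  have hle_avg : ∀ (S : Finset E) (f : E → ℝ) (b : ℝ), (∀ T ∈ 𝒮, μ T ≠ 0 →
      ∑ e ∈ T with e ∈ S, f e ≤ b) → ∑ e ∈ S, x e * f e ≤ b := by
    intro S f b hb
    rw [hx, sum_mixedLoad_mul, ← one_mul b, ← hμ1, Finset.sum_mul]
    refine Finset.sum_le_sum fun T hT => ?_
    by_cases h0 : μ T = 0
    · simp [h0]
    · exact mul_le_mul_of_nonneg_left (hb T hT h0) (hμ T hT)
  have htight : ∀ i < N, ∀ W : Set E, (∀ e ∈ W, ∀ f ∉ W, useCount T i e < useCount T i f) →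
      IsTight G (T i) W := fun i hi W hW =>
    (hT i hi).isTight fun e he f hf => useCount_lt_of_load_lt (hW e he f hf)
  have hfilter : ∀ T₁ : Finset E, IsSpanningTree G T₁ → ∀ (S : Finset E) (q : E → Prop),
      (∀ f ∈ G.edgeSet, f ∈ S ↔ q f) → T₁.filter (· ∈ S) = T₁.filter q :=
    fun T₁ hT₁ S q hq => Finset.filter_congr fun f hf => hq f (hT₁.1 hf)
  have hup : ε * useCount T t e ≤ Real.log m + (ε + ε ^ 2) * x e * t := by
    set S : Finset E := {f | f ∈ G.edgeSet ∧ x f ≤ x e} with hS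
    refine mul_useCount_le (S := S) (N := N) (by rwa [abs_of_pos hε]) (hx0 e) (fun i hi => ?_) ht
      (hcard S fun f hf => by simp [hS] at hf; exact hf.1) (by simp [hS, he])
    refine mul_le_mul_of_nonneg_left ?_ (by linarith [Real.add_one_le_exp ε])
    refine le_trans (b := ∑ f ∈ S, x f * Real.exp (ε * useCount T i f))
      (havg_le S _ _ fun T' hT' h0 => ?_) ?_
    · have hq : ∀ f ∈ G.edgeSet, f ∈ S ↔ f ∈ {f | x f ≤ x e} := fun f hf => by simp [hS, hf]
      rw [hfilter _ (hT i hi).1 S _ hq, hfilter _ (h𝒮 T' hT') S _ hq]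
      refine sum_filter_le_of_isTight (hT i hi).1 ((hmin T' hT' h0).isTight fun f hf g hg => ?_)
        (fun _ => (Real.exp_pos _).le) fun r => htight i hi _ fun f hf g hg => ?_
      · simp only [Set.mem_ofPred_eq, not_le] at hf hg; linarith
      · simp only [Set.mem_ofPred_eq, not_lt] at hf hg
        have := Real.exp_lt_exp.1 (hf.trans_le hg)
        exact_mod_cast lt_of_mul_lt_mul_left this hε.le
    · rw [Finset.mul_sum]
      refine Finset.sum_le_sum fun f hf => ?_
      simp [hS] at hf
      gcongr
      exact hf.2
  have hlow : -ε * useCount T t e ≤ Real.log m + (-ε + (-ε) ^ 2) * x e * t := by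
    set S : Finset E := {f | f ∈ G.edgeSet ∧ x e ≤ x f} with hS
    refine mul_useCount_le (S := S) (N := N) (by rwa [abs_neg, abs_of_pos hε]) (hx0 e)
      (fun i hi => ?_) ht
      (hcard S fun f hf => by simp [hS] at hf; exact hf.1) (by simp [hS, he])
    refine mul_le_mul_of_nonpos_left ?_
      (by linarith [Real.exp_le_one_iff.2 (neg_nonpos.2 hε.le)])
    refine le_trans (b := ∑ f ∈ S, x f * Real.exp (-ε * useCount T i f)) ?_
      (hle_avg S _ _ fun T' hT' h0 => ?_)
    · rw [Finset.mul_sum]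
      refine Finset.sum_le_sum fun f hf => ?_
      simp [hS] at hf
      gcongr
      exact hf.2
    · have hq : ∀ f ∈ G.edgeSet, f ∈ S ↔ f ∉ {f | x f < x e} := fun f hf => by simp [hS, hf]
      rw [hfilter _ (hT i hi).1 S _ hq, hfilter _ (h𝒮 T' hT') S _ hq]
      convert sum_filter_notMem_le_of_isTight (T := T i) (A := {f | x f < x e})
        (f := fun f => Real.exp (-ε * useCount T i f)) (h𝒮 T' hT')
        ((hmin T' hT' h0).isTight fun f hf g hg => ?_)
        (fun _ => (Real.exp_pos _).le) fun r => htight i hi _ fun f hf g hg => ?_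
      · simp only [Set.mem_ofPred_eq, not_lt] at hf hg; linarith
      · simp only [Set.mem_ofPred_eq, not_le] at hf hg
        have := Real.exp_lt_exp.1 (hg.trans_le hf)
        simp only [neg_mul, neg_lt_neg_iff] at this
        exact_mod_cast lt_of_mul_lt_mul_left this hε.le
  rw [load_range]
  have hεt : 0 < ε * t := mul_pos hε ht0'
  have e1 : (useCount T t e : ℝ) / t - x e = (ε * useCount T t e - ε * x e * t) / (ε * t) := by
    field_simp
  have e2 : Real.log m / (ε * t) + ε * x e = (Real.log m + ε ^ 2 * x e * t) / (ε * t) := by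
    field_simp
  rw [e1, e2, abs_div, abs_of_pos hεt]
  gcongr
  rw [abs_le]
  constructor <;> nlinarith

end Greedy

/-! ### Cuts and the minimum cut -/

section Cuts

variable {V E : Type*} {G : Graph V E}

lemma mem_boundary_iff {S : Set V} {e : E} {x y : V} (h : G.IsLink e x y) :
    e ∈ boundary G S ↔ ¬(x ∈ S ↔ y ∈ S) := by
  constructor
  · rintro ⟨x', y', h', hx, hy⟩
    rcases h.eq_and_eq_or_eq_and_eq h' with ⟨rfl, rfl⟩ | ⟨rfl, rfl⟩ <;> tauto
  · intro hxy
    by_cases hx : x ∈ S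
    · exact ⟨x, y, h, hx, by tauto⟩
    · exact ⟨y, x, h.symm, by tauto, hx⟩

lemma boundary_subset_edgeSet (S : Set V) : boundary G S ⊆ G.edgeSet := by
  rintro e ⟨x, y, h, -⟩
  exact h.edge_mem

lemma IsSpanningTree.joined {T : Finset E} (hT : IsSpanningTree G T) (u v : G.vertexSet) :
    Joined G (T : Set E) u v :=
  hT.2.1.preconnected u v

lemma IsSpanningTree.exists_mem_boundary {T : Finset E} (hT : IsSpanningTree G T) {S : Set V}
    (hS : S ⊆ G.vertexSet) (hne : S.Nonempty) (hne' : S ≠ G.vertexSet) :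
    ∃ e ∈ T, e ∈ boundary G S := by
  by_contra! hno
  obtain ⟨u, hu⟩ := hne
  refine hne' (hS.antisymm fun v hv => ?_)
  have := (hT.joined ⟨u, hS hu⟩ ⟨v, hv⟩).elim (R := fun a b => (a : V) ∈ S ↔ (b : V) ∈ S)
    ⟨fun _ => Iff.rfl, Iff.symm, Iff.trans⟩ fun e he a b hab => by
      have := hno e he
      rw [mem_boundary_iff hab] at this
      tauto
  exact this.1 hu

open Classical in
/-- A cut is determined by the edges of a spanning tree that it contains. -/
lemma IsCut.eq_of_filter_eq {T C C' : Finset E} (hT : IsSpanningTree G T) (hC : IsCut G C)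
    (hC' : IsCut G C') (h : {e ∈ T | e ∈ C} = {e ∈ T | e ∈ C'}) : C = C' := by
  obtain ⟨S, -, -, -, hS⟩ := hC
  obtain ⟨S', -, -, -, hS'⟩ := hC'
  have hmem : ∀ e, e ∈ C ↔ e ∈ boundary G S := fun e => by rw [← hS, Finset.mem_coe]
  have hmem' : ∀ e, e ∈ C' ↔ e ∈ boundary G S' := fun e => by rw [← hS', Finset.mem_coe]
  -- The two sides either agree on every vertex or are complementary.
  have key : ∀ u v : G.vertexSet,
      ((((u : V) ∈ S) ↔ (u : V) ∈ S') ↔ (((v : V) ∈ S) ↔ (v : V) ∈ S')) := by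
    intro u v
    refine (hT.joined u v).elim (R := fun u v =>
      ((((u : V) ∈ S) ↔ (u : V) ∈ S') ↔ (((v : V) ∈ S) ↔ (v : V) ∈ S')))
      ⟨fun _ => Iff.rfl, Iff.symm, Iff.trans⟩ fun e he a b hab => ?_
    have h1 : e ∈ C ↔ e ∈ C' := by
      have := Finset.ext_iff.1 h e
      simpa [Finset.mem_coe.1 he] using this
    rw [hmem, hmem', mem_boundary_iff hab, mem_boundary_iff hab] at h1
    tauto
  ext e
  rw [hmem, hmem']
  by_cases he : e ∈ G.edgeSet
  · obtain ⟨x, y, hxy⟩ := G.exists_isLink_of_mem_edgeSet he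
    have := key ⟨x, hxy.left_mem⟩ ⟨y, hxy.right_mem⟩
    rw [mem_boundary_iff hxy, mem_boundary_iff hxy]
    dsimp only at this
    tauto
  · exact ⟨fun h => absurd (boundary_subset_edgeSet S h) he,
      fun h => absurd (boundary_subset_edgeSet S' h) he⟩

lemma minCut_le_card {C : Finset E} (hC : IsCut G C) : minCut G ≤ C.card :=
  Nat.sInf_le ⟨C, hC, rfl⟩

lemma exists_isCut_boundary [Finite E] {S : Set V} (hS : S ⊆ G.vertexSet) (hne : S.Nonempty)
    (hne' : S ≠ G.vertexSet) : ∃ C : Finset E, IsCut G C ∧ (C : Set E) = boundary G S :=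
  ⟨(Set.toFinite (boundary G S)).toFinset, ⟨S, hS, hne, hne', by simp⟩, by simp⟩

lemma exists_isCut_card_eq_minCut [Finite E] (h : 2 ≤ G.vertexSet.ncard) :
    ∃ C : Finset E, IsCut G C ∧ C.card = minCut G := by
  obtain ⟨v, hv⟩ := Set.nonempty_of_ncard_ne_zero (by omega : G.vertexSet.ncard ≠ 0)
  obtain ⟨C, hC, -⟩ := exists_isCut_boundary (G := G) (S := {v}) (by simpa using hv)
    (Set.singleton_nonempty v) (by rintro hv'; rw [← hv', Set.ncard_singleton] at h; omega)
  exact Nat.sInf_mem (s := {k | ∃ C : Finset E, IsCut G C ∧ C.card = k}) ⟨_, C, hC, rfl⟩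

lemma IsSpanningTree.minCut_pos [Finite E] {T : Finset E} (hT : IsSpanningTree G T)
    (h : 2 ≤ G.vertexSet.ncard) : 0 < minCut G := by
  obtain ⟨C, ⟨S, hS, hne, hne', hCS⟩, hC⟩ := exists_isCut_card_eq_minCut (G := G) h
  obtain ⟨e, -, he⟩ := hT.exists_mem_boundary hS hne hne'
  rw [← hCS] at he
  exact hC ▸ Finset.card_pos.2 ⟨e, he⟩

lemma pow_minCut_le_zG [Fintype E] (h : 2 ≤ G.vertexSet.ncard) {p : ℝ} (hp : 0 ≤ p) :
    p ^ minCut G ≤ zG G p := by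
  obtain ⟨C, hC, hcard⟩ := exists_isCut_card_eq_minCut (G := G) h
  rw [← hcard, zG]
  exact Finset.single_le_sum (f := fun C : Finset E => p ^ C.card) (fun C _ => by positivity)
    (by simpa using hC)

/-- Each component of the graph `(V(G), F)` is left by at least `λ` edges outside `F`, and each of
these edges leaves at most two components. -/
lemma numContracted_mul_minCut_le [Finite V] [Finite E] {F : Set E} (hF : 2 ≤ numContracted G F)
    {B : Finset E} (hB : ∀ e ∈ G.edgeSet, e ∉ F → e ∈ B) :
    numContracted G F * minCut G ≤ 2 * B.card := by
  classical
  have := Fintype.ofFinite (Quot (Joined G F))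
  rw [numContracted_eq, Nat.card_eq_fintype_card] at hF ⊢
  set side : Quot (Joined G F) → Set V := fun c => {v | ∃ h : v ∈ G.vertexSet,
    Quot.mk (Joined G F) ⟨v, h⟩ = c} with hside
  have hcut : ∀ c, minCut G ≤ {e ∈ B | e ∈ boundary G (side c)}.card := by
    intro c
    have hsub : side c ⊆ G.vertexSet := fun v ⟨h, _⟩ => h
    have hne : (side c).Nonempty := by
      obtain ⟨⟨v, hv⟩, rfl⟩ := Quot.exists_rep c
      exact ⟨v, hv, rfl⟩
    have hne' : side c ≠ G.vertexSet := by
      intro heq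
      obtain ⟨d, hd⟩ := Fintype.exists_ne_of_one_lt_card hF c
      obtain ⟨⟨v, hv⟩, rfl⟩ := Quot.exists_rep d
      obtain ⟨_, h⟩ : v ∈ side c := heq ▸ hv
      exact hd h
    obtain ⟨C, hC, hCS⟩ := exists_isCut_boundary (G := G) hsub hne hne'
    refine (minCut_le_card hC).trans (Finset.card_le_card fun e he => ?_)
    have he' : e ∈ boundary G (side c) := hCS ▸ Finset.mem_coe.2 he
    refine Finset.mem_filter.2 ⟨hB e (boundary_subset_edgeSet _ he') fun heF => ?_, he'⟩
    obtain ⟨x, y, hxy, ⟨hx, hxc⟩, hy⟩ := he'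
    refine hy ⟨hxy.right_mem, ?_⟩
    rw [← hxc]
    exact quot_joined_eq.2 (joined_of_isLink (u := ⟨x, hx⟩) (v := ⟨y, hxy.right_mem⟩) heF hxy).symm
  have htwo : ∀ e ∈ B, (Finset.univ.filter fun c => e ∈ boundary G (side c)).card ≤ 2 := by
    intro e _
    by_cases he : e ∈ G.edgeSet
    · obtain ⟨x, y, hxy⟩ := G.exists_isLink_of_mem_edgeSet he
      refine (Finset.card_le_card (t := {Quot.mk (Joined G F) ⟨x, hxy.left_mem⟩,
        Quot.mk (Joined G F) ⟨y, hxy.right_mem⟩}) fun c hc => ?_).trans Finset.card_le_two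
      rw [Finset.mem_filter, mem_boundary_iff hxy] at hc
      by_cases hx : x ∈ side c
      · obtain ⟨_, rfl⟩ := hx
        simp
      · obtain ⟨_, rfl⟩ : y ∈ side c := by tauto
        simp
    · rw [Finset.filter_false_of_mem fun c _ h => he (boundary_subset_edgeSet _ h)]
      simp
  calc Fintype.card (Quot (Joined G F)) * minCut G
      = ∑ c : Quot (Joined G F), minCut G := by simp
    _ ≤ ∑ c : Quot (Joined G F), {e ∈ B | e ∈ boundary G (side c)}.card :=
        Finset.sum_le_sum fun c _ => hcut c
    _ = ∑ e ∈ B, (Finset.univ.filter fun c => e ∈ boundary G (side c)).card := by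
        simp_rw [Finset.card_filter]
        exact Finset.sum_comm
    _ ≤ ∑ e ∈ B, 2 := Finset.sum_le_sum htwo
    _ = 2 * B.card := by simp [mul_comm]

/-- The ideal loads are at most `2 / λ`: the set of the edges of maximum load `a` separates some
`k ≥ 2` components, has total load `k - 1`, and consists of at least `k λ / 2` edges. -/
lemma mixedLoad_mul_minCut_le [Finite V] [Finite E] {𝒮 : Finset (Finset E)}
    (h𝒮 : ∀ T ∈ 𝒮, IsSpanningTree G T) {μ : Finset E → ℝ}
    (hμ1 : ∑ T ∈ 𝒮, μ T = 1)
    (hmin : ∀ T ∈ 𝒮, μ T ≠ 0 → IsMinSpanningTree G (mixedLoad 𝒮 μ) T) (e : E) :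
    mixedLoad 𝒮 μ e * minCut G ≤ 2 := by
  classical
  have := Fintype.ofFinite E
  have hne : Nonempty E := ⟨e⟩
  obtain ⟨e₀, he₀⟩ := Finite.exists_max (mixedLoad 𝒮 μ)
  set x := mixedLoad 𝒮 μ with hx
  refine (mul_le_mul_of_nonneg_right (he₀ e) (Nat.cast_nonneg _)).trans ?_
  rcases le_or_gt (x e₀) 0 with ha | ha
  · exact (mul_nonpos_of_nonpos_of_nonneg ha (Nat.cast_nonneg _)).trans (by norm_num)
  set A : Set E := {f | x f < x e₀} with hA
  set B : Finset E := {f | f ∉ A} with hB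
  have hBx : ∀ f ∈ B, x f = x e₀ := fun f hf =>
    le_antisymm (he₀ f) (by simpa [hB, hA] using hf)
  have he₀B : e₀ ∈ B := by simp [hB, hA]
  -- The total load of the heaviest edges.
  have htotal : B.card * x e₀ = numContracted G A - 1 := by
    have h1 : ∑ f ∈ B, x f * 1 = ∑ T ∈ 𝒮, μ T * (numContracted G A - 1 : ℝ) := by
      rw [hx, sum_mixedLoad_mul]
      refine Finset.sum_congr rfl fun T hT => ?_
      by_cases h0 : μ T = 0
      · simp [h0]
      · have h2 := (h𝒮 T hT).card_filter_notMem_of_isTight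
          ((hmin T hT h0).isTight (W := A) fun f hf g hg => by
            simp only [hA, Set.mem_ofPred_eq, not_lt] at hf hg; linarith)
        have h3 : ({e ∈ T | e ∉ A}.card : ℝ) + 1 = numContracted G A := by exact_mod_cast h2
        rw [← h3]
        simp [hB]
    rw [← Finset.sum_mul, ← Finset.sum_mul, hμ1, one_mul, mul_one] at h1
    rw [← h1, Finset.sum_congr rfl hBx, Finset.sum_const, nsmul_eq_mul]
  have hBpos : (0 : ℝ) < B.card := by exact_mod_cast Finset.card_pos.2 ⟨e₀, he₀B⟩
  have hk : 2 ≤ numContracted G A := by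
    by_contra hlt
    have : (numContracted G A : ℝ) ≤ 1 := by exact_mod_cast (by omega : numContracted G A ≤ 1)
    have := mul_pos hBpos ha
    linarith
  have hdeg : (numContracted G A * minCut G : ℝ) ≤ 2 * B.card := by
    exact_mod_cast numContracted_mul_minCut_le hk (B := B) fun f _ hf => by simp [hB, hf]
  have hk0 : (0 : ℝ) < numContracted G A := by exact_mod_cast (by omega : 0 < numContracted G A)
  refine le_of_mul_le_mul_left ?_ hk0
  nlinarith [mul_le_mul_of_nonneg_right hdeg ha.le]

end Cuts

/-! ### Level sums in the reliable case -/

section Levels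

/-- The reliability hypothesis at a level `π` bounds the contribution of the at most `k` edges
there. The factor `n ^ (30 * δ)` of the hypothesis pays for the smaller exponent. -/
lemma mul_rpow_le_one_of_reliable {n k δ p π : ℝ} (hδ : 0 < δ) (hδ1 : δ ≤ 1 / 100) (hp : 0 < p)
    (hk : 1 ≤ k) (hkn : k ≤ n) (h : n ^ (1 + 30 * δ) * k * p ^ (2 * π) ≤ 1) :
    k * p ^ ((1 - 8 * δ) * π) ≤ 1 := by
  have hk0 : 0 < k := by linarith
  have hn0 : 0 < n := by linarith
  have hb : 0 ≤ Real.log k := Real.log_nonneg hk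
  have hba : Real.log k ≤ Real.log n := Real.log_le_log hk0 hkn
  rw [← Real.log_nonpos_iff (by positivity), Real.log_mul (by positivity) (by positivity),
    Real.log_mul (by positivity) (by positivity), Real.log_rpow hn0, Real.log_rpow hp] at h
  rw [← Real.log_nonpos_iff (by positivity), Real.log_mul (by positivity) (by positivity),
    Real.log_rpow hp]
  have h1 : (1 - 8 * δ) / 2 * ((1 + 30 * δ) * Real.log n + Real.log k + 2 * π * Real.log p) ≤ 0 :=
    mul_nonpos_of_nonneg_of_nonpos (by linarith) h
  have h2 : (1 - (1 - 8 * δ) / 2) * (Real.log n - Real.log k) ≥ 0 :=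
    mul_nonneg (by linarith) (by linarith)
  have h3 : 0 ≤ (7 * δ - 120 * δ ^ 2) * Real.log n :=
    mul_nonneg (by nlinarith) (by linarith)
  nlinarith

/-- In the reliable case the weights `p ^ ((1 - η) / ℓ e)` of the edges of a tree have a small sum.
The edges are grouped by the levels `π_i` up to about `5 / 4 * λ`, of which there are `O(1 / δ)`;
each level contributes at most `1`, and so do all the edges beyond the last level together. -/
lemma sum_rpow_inv_load_le {E : Type*} {T : Finset E} {ℓ : E → ℝ} {n : ℕ} {lam δ p η : ℝ}
    {k : ℕ → ℕ} (hlam : 0 < lam) (hδ : 0 < δ) (hδ1 : δ ≤ 1 / 100) (hp : 0 < p) (hp1 : p < 1)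
    (hη1 : η ≤ δ / 2) (hT : T.card ≤ n) (hpos : ∀ e ∈ T, 0 < ℓ e)
    (hmax : ∀ e ∈ T, ℓ e ≤ (2 + 3 / 2 * δ) / lam) (hk : ∀ i, 1 ≤ k i) (hkn : ∀ i, k i ≤ n)
    (hcount : ∀ i, (1 + δ) ^ i * lam / 2 ≤ 3 / 2 * lam →
      {e ∈ T | 1 / ((1 + δ) ^ i * lam / 2) + 4 * δ / lam < ℓ e}.card ≤ k i)
    (hrel : ∀ i : ℕ, (n : ℝ) ^ (1 + 30 * δ) * k i * p ^ (2 * ((1 + δ) ^ i * lam / 2)) ≤ 1) :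
    ∑ e ∈ T, p ^ ((1 - η) / ℓ e) ≤ 3 / 2 / δ + 3 := by
  classical
  set π : ℕ → ℝ := fun i => (1 + δ) ^ i * lam / 2 with hπ
  have hπpos : ∀ i, 0 < π i := fun i => by simp only [hπ]; positivity
  have hkn' : ∀ i, (k i : ℝ) ≤ n := fun i => by exact_mod_cast hkn i
  have hk' : ∀ i, (1 : ℝ) ≤ k i := fun i => by exact_mod_cast hk i
  have hn : (1 : ℝ) ≤ n := (hk' 0).trans (hkn' 0)
  -- The last level `I`.
  have hex : ∃ i : ℕ, (5 / 2 : ℝ) ≤ (1 + δ) ^ i :=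
    (pow_unbounded_of_one_lt (5 / 2) (by linarith : 1 < 1 + δ)).imp fun _ h => h.le
  obtain ⟨J, hJ⟩ : ∃ J, Nat.find hex = J + 1 := Nat.exists_eq_succ_of_ne_zero fun h0 => by
    have := Nat.find_spec hex
    rw [h0] at this; norm_num at this
  have hI1 : (5 / 2 : ℝ) ≤ (1 + δ) ^ (J + 1) := hJ ▸ Nat.find_spec hex
  have hJ1 : (1 + δ) ^ J < (5 / 2 : ℝ) := not_le.1 (Nat.find_min hex (by omega))
  have hI2 : (1 + δ) ^ (J + 1) ≤ (3 : ℝ) := by rw [pow_succ]; nlinarith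
  have hJδ : J * δ ≤ 3 / 2 := by
    have := one_add_mul_le_pow (by linarith : (-2 : ℝ) ≤ δ) J
    linarith
  have hπle : ∀ i ≤ J + 1, π i ≤ 3 / 2 * lam := fun i hi => by
    have : (1 + δ) ^ i ≤ (1 + δ) ^ (J + 1) := pow_le_pow_right₀ (by linarith) hi
    simp only [hπ]; nlinarith
  -- An edge outside the first `i` levels has weight at most that of the level `π i`.
  have hout : ∀ i ≤ J + 1, ∀ e ∈ T, ¬ 1 / π i + 4 * δ / lam < ℓ e →
      π i / (1 + 6 * δ) ≤ 1 / ℓ e := by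
    intro i hi e he hle
    rw [not_lt] at hle
    have h1 : 4 * δ / lam ≤ 6 * δ / π i := by
      rw [div_le_div_iff₀ hlam (hπpos i)]
      nlinarith [hπle i hi]
    have h2 : ℓ e ≤ (1 + 6 * δ) / π i := by rw [add_div]; linarith
    rw [div_le_div_iff₀ (by linarith) (hpos e he), one_mul]
    rw [le_div_iff₀ (hπpos i)] at h2
    linarith
  have hone : ∀ i, (k i : ℝ) * p ^ ((1 - 8 * δ) * π i) ≤ 1 := fun i =>
    mul_rpow_le_one_of_reliable hδ hδ1 hp (hk' i) (hkn' i) (hrel i)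
  have hδ2 : δ ^ 2 ≤ δ / 100 := by nlinarith
  have hmain : ∀ e ∈ T, p ^ ((1 - η) / ℓ e) ≤ p ^ lam + ∑ i ∈ Finset.range (J + 2),
      if 1 / π i + 4 * δ / lam < ℓ e then p ^ ((1 - 8 * δ) * π i) else 0 := by
    intro e he
    have hterm : ∀ i, 0 ≤ if 1 / π i + 4 * δ / lam < ℓ e then p ^ ((1 - 8 * δ) * π i) else 0 :=
      fun i => by split_ifs <;> positivity
    have hle : ∀ i ≤ J + 1, 1 / π i + 4 * δ / lam < ℓ e →
        (1 - 8 * δ) * π i ≤ (1 - η) / ℓ e → p ^ ((1 - η) / ℓ e) ≤ p ^ lam +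
          ∑ i ∈ Finset.range (J + 2),
            if 1 / π i + 4 * δ / lam < ℓ e then p ^ ((1 - 8 * δ) * π i) else 0 := by
      intro i hi hin hexp
      have h1 := Finset.single_le_sum (fun i _ => hterm i)
        (Finset.mem_range.2 (by omega : i < J + 2))
      rw [if_pos hin] at h1
      have h2 := Real.rpow_le_rpow_of_exponent_ge hp hp1.le hexp
      have h3 : 0 < p ^ lam := by positivity
      linarith
    by_cases hin : 1 / π (J + 1) + 4 * δ / lam < ℓ e
    · have hexi : ∃ i, 1 / π i + 4 * δ / lam < ℓ e := ⟨_, hin⟩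
      have hfind : Nat.find hexi ≤ J + 1 := Nat.find_min' hexi hin
      rcases hi : Nat.find hexi with _ | j
      · refine hle 0 (by omega) (hi ▸ Nat.find_spec hexi) ?_
        have h1 := hmax e he
        rw [le_div_iff₀ hlam] at h1
        rw [le_div_iff₀ (hpos e he)]
        have h2 : π 0 * ℓ e ≤ 1 + 3 / 4 * δ := by simp only [hπ, pow_zero]; linarith
        calc (1 - 8 * δ) * π 0 * ℓ e = (1 - 8 * δ) * (π 0 * ℓ e) := by ring
          _ ≤ (1 - 8 * δ) * (1 + 3 / 4 * δ) := mul_le_mul_of_nonneg_left h2 (by linarith)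
          _ ≤ 1 - η := by nlinarith
      · refine hle (j + 1) (by omega) (hi ▸ Nat.find_spec hexi) ?_
        have h1 := hout j (by omega) e he (Nat.find_min hexi (by omega))
        have h2 : π (j + 1) = π j * (1 + δ) := by simp only [hπ, pow_succ]; ring
        calc (1 - 8 * δ) * π (j + 1)
            = ((1 - 8 * δ) * (1 + δ) * (1 + 6 * δ)) * (π j / (1 + 6 * δ)) := by
              rw [h2]; field_simp
          _ ≤ (1 - η) * (1 / ℓ e) := by
              have := hπpos j
              refine mul_le_mul ?_ h1 (by positivity) (by linarith)
              nlinarith [mul_nonneg hδ.le (sq_nonneg δ)]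
          _ = (1 - η) / ℓ e := by ring
    · have h1 := hout (J + 1) le_rfl e he hin
      have h2 : 5 / 4 * lam ≤ π (J + 1) := by simp only [hπ]; nlinarith
      have h3 : lam ≤ (1 - η) / ℓ e := by
        calc lam ≤ (1 - η) * (5 / 4 * lam / (1 + 6 * δ)) := by
              rw [mul_div_assoc', le_div_iff₀ (by linarith)]
              nlinarith
          _ ≤ (1 - η) * (1 / ℓ e) := by
              refine mul_le_mul_of_nonneg_left (le_trans ?_ h1) (by linarith)
              gcongr
          _ = (1 - η) / ℓ e := by ring
      have h4 := Real.rpow_le_rpow_of_exponent_ge hp hp1.le h3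
      have h5 := Finset.sum_nonneg fun i (_ : i ∈ Finset.range (J + 2)) => hterm i
      linarith
  -- The edges beyond the last level: the hypothesis at level `0` gives `n * p ^ λ ≤ 1`.
  have hlast : (T.card : ℝ) * p ^ lam ≤ 1 := by
    have h1 := hrel 0
    have h2 : (n : ℝ) ≤ n ^ (1 + 30 * δ) := by
      conv_lhs => rw [← Real.rpow_one (n : ℝ)]
      exact Real.rpow_le_rpow_of_exponent_le hn (by linarith)
    rw [show 2 * ((1 + δ) ^ 0 * lam / 2) = lam by ring] at h1
    have h3 : (T.card : ℝ) ≤ n := by exact_mod_cast hT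
    have h4 : (n : ℝ) ≤ n ^ (1 + 30 * δ) * k 0 := by
      have := mul_le_mul_of_nonneg_left (hk' 0) (by positivity : 0 ≤ (n : ℝ) ^ (1 + 30 * δ))
      linarith
    exact (mul_le_mul_of_nonneg_right (h3.trans h4) (by positivity)).trans h1
  calc ∑ e ∈ T, p ^ ((1 - η) / ℓ e)
      ≤ ∑ e ∈ T, (p ^ lam + ∑ i ∈ Finset.range (J + 2),
          if 1 / π i + 4 * δ / lam < ℓ e then p ^ ((1 - 8 * δ) * π i) else 0) :=
        Finset.sum_le_sum hmain
    _ = T.card * p ^ lam + ∑ i ∈ Finset.range (J + 2),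
          ({e ∈ T | 1 / π i + 4 * δ / lam < ℓ e}.card : ℝ) * p ^ ((1 - 8 * δ) * π i) := by
        rw [Finset.sum_add_distrib, Finset.sum_const, nsmul_eq_mul, Finset.sum_comm]
        congr 1
        refine Finset.sum_congr rfl fun i _ => ?_
        rw [← Finset.sum_filter, Finset.sum_const, nsmul_eq_mul]
    _ ≤ 1 + ∑ i ∈ Finset.range (J + 2), 1 := by
        refine add_le_add hlast (Finset.sum_le_sum fun i hi => ?_)
        refine le_trans ?_ (hone i)
        gcongr
        exact hcount i (hπle i (by have := Finset.mem_range.1 hi; omega))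
    _ = J + 3 := by simp; ring
    _ ≤ 3 / 2 / δ + 3 := by
        have : (J : ℝ) ≤ 3 / 2 / δ := by rwa [le_div_iff₀ hδ]
        linarith

end Levels

/-! ### Counting cuts of large load -/

section Counting

open Classical in
/-- Double counting: an average over the trees of a sum over their edges is a sum weighted by the
loads. -/
lemma sum_load_mul {ι E : Type*} (T : ι → Finset E) (s : Finset ι) (C : Finset E) (f : E → ℝ) :
    ∑ e ∈ C, load T s e * f e = ∑ i ∈ s, (s.card : ℝ)⁻¹ * ∑ e ∈ T i with e ∈ C, f e := by
  have h : ∀ i, (T i).filter (· ∈ C) = C.filter (· ∈ T i) := fun i => by ext; simp [and_comm]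
  simp_rw [h, Finset.sum_filter, Finset.mul_sum]
  rw [Finset.sum_comm]
  refine Finset.sum_congr rfl fun e _ => ?_
  simp only [load, Finset.card_filter, Nat.cast_sum, Finset.sum_div, Finset.sum_mul]
  refine Finset.sum_congr rfl fun i _ => ?_
  split_ifs <;> simp [div_eq_inv_mul]

open Classical in
/-- Jensen's inequality for the average over the trees. A cut `C` satisfies
`|C| ≥ avg_T ∑_{e ∈ T ∩ C} 1 / ℓ e` and `ℓ(C) = avg_T |T ∩ C|`, and a cut of large load also has
`λ ≤ η |C|`, so that a factor `p ^ λ` can be split off. -/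
lemma pow_card_le_avg_prod {ι E : Type*} {T : ι → Finset E} {s : Finset ι} (hs : s.Nonempty)
    {C : Finset E} {p η b : ℝ} {lam : ℕ} (hp : 0 < p) (hp1 : p < 1) (hη1 : η ≤ 1)
    (hlam : lam ≤ η * C.card) (hb : b ≤ ∑ e ∈ C, load T s e) :
    p ^ C.card ≤ p ^ lam * Real.exp (-b) * ∑ i ∈ s, (s.card : ℝ)⁻¹ *
      ∏ e ∈ T i with e ∈ C, (Real.exp 1 * p ^ ((1 - η) / load T s e)) := by
  have hlog : Real.log p < 0 := Real.log_neg hp hp1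
  have hs0 : (0 : ℝ) < s.card := by exact_mod_cast Finset.card_pos.2 hs
  set f : E → ℝ := fun e => 1 + Real.log p * ((1 - η) / load T s e) with hf
  have hprod : ∀ i, ∏ e ∈ T i with e ∈ C, (Real.exp 1 * p ^ ((1 - η) / load T s e)) =
      Real.exp (∑ e ∈ T i with e ∈ C, f e) := fun i => by
    rw [Real.exp_sum]
    refine Finset.prod_congr rfl fun e _ => ?_
    rw [Real.rpow_def_of_pos hp, ← Real.exp_add]
  simp_rw [hprod]
  have hjensen : Real.exp (∑ i ∈ s, (s.card : ℝ)⁻¹ * ∑ e ∈ T i with e ∈ C, f e) ≤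
      ∑ i ∈ s, (s.card : ℝ)⁻¹ * Real.exp (∑ e ∈ T i with e ∈ C, f e) := by
    have := convexOn_exp.map_sum_le (t := s) (w := fun _ => (s.card : ℝ)⁻¹)
      (p := fun i => ∑ e ∈ T i with e ∈ C, f e) (fun _ _ => by positivity)
      (by rw [Finset.sum_const, nsmul_eq_mul, mul_inv_cancel₀ hs0.ne']) (fun _ _ => Set.mem_univ _)
    simpa only [smul_eq_mul] using this
  rw [← sum_load_mul] at hjensen
  have hsum : b + (1 - η) * C.card * Real.log p ≤ ∑ e ∈ C, load T s e * f e := by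
    have h1 : ∑ e ∈ C, (load T s e + (1 - η) * Real.log p) ≤ ∑ e ∈ C, load T s e * f e := by
      refine Finset.sum_le_sum fun e _ => ?_
      -- An edge of load `0` contributes `0` on the right-hand side.
      by_cases h0 : load T s e = 0
      · rw [h0, zero_mul, zero_add]
        exact mul_nonpos_of_nonneg_of_nonpos (by linarith) hlog.le
      · apply le_of_eq
        simp only [hf]
        field_simp
    rw [Finset.sum_add_distrib, Finset.sum_const, nsmul_eq_mul] at h1
    linarith
  have hfinal : p ^ C.card ≤ p ^ lam * Real.exp (-b) * Real.exp (∑ e ∈ C, load T s e * f e) := by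
    rw [← Real.rpow_natCast, ← Real.rpow_natCast, Real.rpow_def_of_pos hp,
      Real.rpow_def_of_pos hp, ← Real.exp_add, ← Real.exp_add, Real.exp_le_exp]
    nlinarith
  refine hfinal.trans (mul_le_mul_of_nonneg_left hjensen (by positivity))

variable {V E : Type*} {G : Graph V E}

open Classical in
/-- As cuts are determined by their edges in a spanning tree `T`, a sum over cuts is at most a sum
over the subsets of `T`. -/
lemma sum_prod_filter_le {T : Finset E} (hT : IsSpanningTree G T) {𝒞 : Finset (Finset E)}
    (h𝒞 : ∀ C ∈ 𝒞, IsCut G C) {y : E → ℝ} (hy : ∀ e, 0 ≤ y e) :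
    ∑ C ∈ 𝒞, ∏ e ∈ T with e ∈ C, y e ≤ Real.exp (∑ e ∈ T, y e) := by
  have hinj : Set.InjOn (fun C : Finset E => {e ∈ T | e ∈ C}) 𝒞 := fun C hC C' hC' h =>
    (h𝒞 C hC).eq_of_filter_eq hT (h𝒞 C' hC') h
  calc ∑ C ∈ 𝒞, ∏ e ∈ T with e ∈ C, y e
      = ∑ S ∈ 𝒞.image fun C : Finset E => {e ∈ T | e ∈ C}, ∏ e ∈ S, y e :=
        (Finset.sum_image (f := fun S => ∏ e ∈ S, y e) hinj).symm
    _ ≤ ∑ S ∈ T.powerset, ∏ e ∈ S, y e :=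
        Finset.sum_le_sum_of_subset_of_nonneg
          (Finset.image_subset_iff.2 fun C _ => Finset.mem_powerset.2 (Finset.filter_subset _ _))
          fun S _ _ => Finset.prod_nonneg fun e _ => hy e
    _ = ∏ e ∈ T, (1 + y e) := (Finset.prod_one_add T).symm
    _ ≤ ∏ e ∈ T, Real.exp (y e) :=
        Finset.prod_le_prod (fun e _ => by linarith [hy e])
          fun e _ => by linarith [Real.add_one_le_exp (y e)]
    _ = Real.exp (∑ e ∈ T, y e) := (Real.exp_sum _ _).symm

open Classical in
/-- The cuts of load more than `b` have total weight at most `p ^ λ * exp (B - b)`, where `B`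
bounds the weighted sums over the trees of the packing. -/
lemma sum_pow_card_le_of_load {ι : Type*} {T : ι → Finset E} {s : Finset ι} (hs : s.Nonempty)
    (hT : ∀ i ∈ s, IsSpanningTree G (T i)) {p η b B : ℝ} {lam : ℕ} (hp : 0 < p) (hp1 : p < 1)
    (hη1 : η ≤ 1)
    (hB : ∀ i ∈ s, ∑ e ∈ T i, Real.exp 1 * p ^ ((1 - η) / load T s e) ≤ B)
    {𝒞 : Finset (Finset E)} (h𝒞 : ∀ C ∈ 𝒞, IsCut G C)
    (hlam : ∀ C ∈ 𝒞, lam ≤ η * C.card) (hb : ∀ C ∈ 𝒞, b ≤ ∑ e ∈ C, load T s e) :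
    ∑ C ∈ 𝒞, p ^ C.card ≤ p ^ lam * Real.exp (B - b) := by
  have hs0 : (0 : ℝ) < s.card := by exact_mod_cast Finset.card_pos.2 hs
  calc ∑ C ∈ 𝒞, p ^ C.card
      ≤ ∑ C ∈ 𝒞, p ^ lam * Real.exp (-b) * ∑ i ∈ s, (s.card : ℝ)⁻¹ *
          ∏ e ∈ T i with e ∈ C, (Real.exp 1 * p ^ ((1 - η) / load T s e)) :=
        Finset.sum_le_sum fun C hC =>
          pow_card_le_avg_prod hs hp hp1 hη1 (hlam C hC) (hb C hC)
    _ = p ^ lam * Real.exp (-b) * ∑ i ∈ s, (s.card : ℝ)⁻¹ *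
          ∑ C ∈ 𝒞, ∏ e ∈ T i with e ∈ C, (Real.exp 1 * p ^ ((1 - η) / load T s e)) := by
        rw [← Finset.mul_sum, Finset.sum_comm]
        simp_rw [Finset.mul_sum]
    _ ≤ p ^ lam * Real.exp (-b) * ∑ i ∈ s, (s.card : ℝ)⁻¹ * Real.exp B := by
        gcongr with i hi
        exact (sum_prod_filter_le (hT i hi) h𝒞 fun e => by positivity).trans
          (Real.exp_le_exp.2 (hB i hi))
    _ = p ^ lam * Real.exp (B - b) := by
        rw [Finset.sum_const, nsmul_eq_mul, mul_inv_cancel_left₀ hs0.ne', mul_assoc,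
          ← Real.exp_add]
        ring_nf

end Counting

/-! ### The reliable case -/

section Reliable

variable {V E : Type*} {G : Graph V E}

lemma load_pos_of_mem {ι E : Type*} {T : ι → Finset E} {s : Finset ι} {i : ι} (hi : i ∈ s) {e : E}
    (he : e ∈ T i) : 0 < load T s e := by
  classical
  have h1 : 0 < {j ∈ s | e ∈ T j}.card := Finset.card_pos.2 ⟨i, by simp [hi, he]⟩
  have h2 : 0 < s.card := Finset.card_pos.2 ⟨i, hi⟩
  unfold load
  convert div_pos (Nat.cast_pos (α := ℝ).2 h1) (Nat.cast_pos (α := ℝ).2 h2)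

lemma load_Ico {E : Type*} (T : ℕ → Finset E) {M : ℕ} (hM : 0 < M) (e : E) :
    load T (Finset.Ico M (2 * M)) e =
      2 * load T (Finset.range (2 * M)) e - load T (Finset.range M) e := by
  classical
  have h : useCount T (2 * M) e = useCount T M e + {i ∈ Finset.Ico M (2 * M) | e ∈ T i}.card := by
    simp only [useCount, Finset.card_filter, Finset.range_eq_Ico]
    exact (Finset.sum_Ico_consecutive _ (Nat.zero_le M) (by omega)).symm
  have hM' : (0 : ℝ) < M := by exact_mod_cast hM
  rw [load_range, load_range, h, load]
  push_cast
  rw [Nat.card_Ico, show 2 * M - M = M by omega]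
  field_simp
  ring

/-- From round `M` on, the loads of the greedy packing agree with common ideal loads `x` up to
`δ / (2 λ)`, and `x` is at most `2 / λ`. -/
lemma exists_ideal_load_approx [Finite V] [Finite E] {m M : ℕ} {T : ℕ → Finset E} {δ : ℝ} (hm : m = G.edgeSet.ncard)
    (hδ : 0 < δ) (hδ1 : δ ≤ 1) (hM0 : 0 < M)
    (hlam : 0 < minCut G) (hM : 6 * (minCut G : ℝ) * Real.log m / (δ / 3) ^ 2 ≤ M)
    (hT : IsGreedyTreePacking G (2 * M) T) :
    ∃ x : E → ℝ, (∀ e, x e ≤ 2 / minCut G) ∧ ∀ t, M ≤ t → t ≤ 2 * M → ∀ e,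
      |load T (Finset.range t) e - x e| ≤ δ / (2 * minCut G) := by
  classical
  have := Fintype.ofFinite E
  set 𝒮 : Finset (Finset E) := {S | IsSpanningTree G S} with h𝒮def
  have h𝒮 : ∀ S ∈ 𝒮, IsSpanningTree G S := fun S hS => by simpa [h𝒮def] using hS
  obtain ⟨μ, hμ, hμ1, hmin⟩ := exists_ideal_distribution (𝒮 := 𝒮)
    ⟨T 0, by simpa [h𝒮def] using (hT 0 (by omega)).1⟩
  have hmst : ∀ S ∈ 𝒮, μ S ≠ 0 → IsMinSpanningTree G (mixedLoad 𝒮 μ) S := fun S hS h0 =>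
    ⟨h𝒮 S hS, fun S' hS' => hmin S hS h0 S' (by simpa [h𝒮def] using hS')⟩
  have hlam' : (0 : ℝ) < minCut G := by exact_mod_cast hlam
  have hx : ∀ e, mixedLoad 𝒮 μ e ≤ 2 / minCut G := fun e => by
    rw [le_div_iff₀ hlam']
    exact mixedLoad_mul_minCut_le h𝒮 hμ1 hmst e
  refine ⟨mixedLoad 𝒮 μ, hx, fun t ht ht2 e => ?_⟩
  by_cases he : e ∈ G.edgeSet
  · -- With `ε = δ / 10` the error is `(10 / 54 + 1 / 5) δ / λ`.
    refine (abs_load_sub_mixedLoad_le hT h𝒮 hμ hμ1 hmst hm.ge (ε := δ / 10) (by linarith)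
      (by linarith) (by omega) ht2 he).trans ?_
    have ht' : (M : ℝ) ≤ t := by exact_mod_cast ht
    have htpos : (0 : ℝ) < t := by exact_mod_cast (by omega : 0 < t)
    have h1 : Real.log m / (δ / 10 * t) ≤ 10 / 54 * δ / minCut G := by
      rw [div_le_iff₀ (by positivity)] at hM
      rw [div_le_div_iff₀ (by positivity) hlam']
      have h2 : (M : ℝ) * (δ / 3) ^ 2 ≤ t * (δ / 3) ^ 2 := by gcongr
      nlinarith
    have h2 : δ / 10 * mixedLoad 𝒮 μ e ≤ δ / 10 * (2 / minCut G) := by gcongr; exact hx e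
    have h3 : 10 / 54 * δ / minCut G + δ / 10 * (2 / minCut G) =
        (104 / 270) * (δ / minCut G) := by ring
    have h4 : δ / (2 * minCut G) = (1 / 2) * (δ / (minCut G : ℝ)) := by field_simp
    have h5 : 0 < δ / (minCut G : ℝ) := by positivity
    linarith
  · have h1 : mixedLoad 𝒮 μ e = 0 :=
      Finset.sum_eq_zero fun S hS => if_neg fun h => he ((h𝒮 S hS).1 h)
    have h2 : load T (Finset.range t) e = 0 := by
      have h3 : ∀ i ∈ Finset.range t, e ∉ T i := fun i hi h =>
        he ((hT i (by have := Finset.mem_range.1 hi; omega)).1.1 h)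
      rw [load_range, useCount, Finset.filter_false_of_mem h3]
      simp
    rw [h1, h2, sub_zero, abs_zero]
    positivity

/-- The edges of the tree chosen for the loads `w` that are heavy for the nearby loads `ℓ` belong
to a spanning tree of a contraction with at most `k_τ` vertices. -/
lemma card_heavy_le_kParam [Finite V] {w ℓ : E → ℝ} {T : Finset E} (hT : IsMinSpanningTree G w T) {τ r : ℝ}
    (hwℓ : ∀ e, |w e - ℓ e| ≤ r) : {e ∈ T | 1 / τ + 2 * r < ℓ e}.card ≤ kParam G ℓ τ := by
  classical
  set W : Set E := {e | w e ≤ 1 / τ + r} with hW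
  have htight := hT.1.card_filter_notMem_of_isTight (hT.isTight (W := W) fun e he f hf => by
    simp only [hW, Set.mem_ofPred_eq, not_le] at he hf; linarith)
  have h1 : {e ∈ T | 1 / τ + 2 * r < ℓ e}.card ≤ {e ∈ T | e ∉ W}.card := by
    refine Finset.card_le_card fun e he => ?_
    simp only [hW, Finset.mem_filter, Set.mem_ofPred_eq, not_le] at he ⊢
    exact ⟨he.1, by linarith [(abs_le.1 (hwℓ e)).1]⟩
  have h2 : numContracted G W ≤ kParam G ℓ τ := by
    refine numContracted_anti fun e he => ?_
    simp only [hW, Set.mem_ofPred_eq] at he ⊢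
    linarith [(abs_le.1 (hwℓ e)).2]
  omega

open Classical in
lemma zG_eq_zGRestricted_add [Fintype E] (ℓ : E → ℝ) (b p : ℝ) :
    zG G p = zGRestricted G ℓ b p +
      ∑ C : Finset E with IsCut G C ∧ b < ∑ e ∈ C, ℓ e, p ^ C.card := by
  rw [zG, zGRestricted, ← Finset.sum_filter_add_sum_filter_not _ fun C => ∑ e ∈ C, ℓ e ≤ b,
    Finset.filter_filter, Finset.filter_filter]
  simp only [not_le]

lemma exists_isSpanningTree [Finite V] [Finite E] (hG : G.toSimpleGraph.Connected) :
    ∃ T, IsSpanningTree G T := by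
  have := Fintype.ofFinite E
  have hU : ((Set.toFinite G.edgeSet).toFinset : Set E) = G.edgeSet := by simp
  obtain ⟨T, -, -, hT⟩ := exists_isSpanningTree_between (G := G)
    (Finset.empty_subset (Set.toFinite G.edgeSet).toFinset) hU.le
    (by rw [Finset.coe_empty, numContracted_empty, Finset.card_empty, add_zero])
    (by rwa [hU, numContracted_eq_one_iff_connected, Graph.restrict_self])
  exact ⟨T, hT⟩

/-- The reliable case for small `δ` and large `n`, as quantified by `hn1` and `hn2`. -/
lemma one_sub_inv_mul_zG_le [Finite V] [Fintype E] {n m : ℕ} {δ p : ℝ} {M : ℕ} {T : ℕ → Finset E} {ℓ : E → ℝ}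
    (hn : n = G.vertexSet.ncard) (hm : m = G.edgeSet.ncard) (hn3 : 3 ≤ n)
    (hp : 0 < p) (hp1 : p < 1) (hδ : 0 < δ) (hδ1 : δ ≤ 1 / 100)
    (hn1 : 2 / Real.log n ≤ δ / 2) (hn2 : 3 * (3 / 2 / δ + 3) ≤ Real.log n)
    (hM0 : 0 < M)
    (hM : 6 * (minCut G : ℝ) * Real.log m / (δ / 3) ^ 2 ≤ M)
    (hT : IsGreedyTreePacking G (2 * M) T)
    (hℓ : ℓ = load T (Finset.Ico M (2 * M)))
    (hrel : ∀ i : ℕ, (n : ℝ) ^ (1 + 30 * δ) * (kParam G ℓ (levelPi G δ i) : ℝ) *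
      p ^ (2 * levelPi G δ i) ≤ 1) :
    (1 - 1 / n) * zG G p ≤ zGRestricted G ℓ (2 * Real.log n) p := by
  classical
  have hT0 := (hT 0 (by omega)).1
  have hlamN : 0 < minCut G := hT0.minCut_pos (by omega)
  have hlam : (0 : ℝ) < minCut G := by exact_mod_cast hlamN
  have hn0 : (0 : ℝ) < n := by exact_mod_cast (by omega : 0 < n)
  have hlog : 0 < Real.log n := lt_of_lt_of_le (by positivity) hn2
  obtain ⟨x, hx, happrox⟩ := exists_ideal_load_approx hm hδ (by linarith) hM0 hlamN hM hT
  set lam : ℝ := (minCut G : ℝ) with hlamdef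
  set r : ℝ := δ / (2 * lam) with hr
  have hr' : r = δ / lam / 2 := by rw [hr]; field_simp
  have hδlam : 0 < δ / lam := by positivity
  have hℓx : ∀ e, |ℓ e - x e| ≤ 3 * r := fun e => by
    have h1 := abs_le.1 (happrox M le_rfl (by omega) e)
    have h2 := abs_le.1 (happrox (2 * M) (by omega) le_rfl e)
    rw [hℓ, load_Ico T hM0, abs_le]
    constructor <;> linarith
  have hmax : ∀ e, ℓ e ≤ (2 + 3 / 2 * δ) / lam := fun e => by
    have h1 := (abs_le.1 (hℓx e)).2
    have h2 := hx e
    have h3 : (2 + 3 / 2 * δ) / lam = 2 / lam + 3 / 2 * (δ / lam) := by ring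
    linarith
  have htree : ∀ i ∈ Finset.Ico M (2 * M), IsSpanningTree G (T i) := fun i hi =>
    (hT i (Finset.mem_Ico.1 hi).2).1
  have hlevels : ∀ i ∈ Finset.Ico M (2 * M),
      ∑ e ∈ T i, p ^ ((1 - 2 / Real.log n) / ℓ e) ≤ 3 / 2 / δ + 3 := by
    intro i hi
    obtain ⟨hi1, hi2⟩ := Finset.mem_Ico.1 hi
    have hwℓ : ∀ e, |load T (Finset.range i) e - ℓ e| ≤ 2 * δ / lam := fun e => by
      have h1 := abs_le.1 (happrox i hi1 hi2.le e)
      have h2 := abs_le.1 (hℓx e)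
      have h3 : 2 * δ / lam = 2 * (δ / lam) := by ring
      rw [abs_le]
      constructor <;> linarith
    refine sum_rpow_inv_load_le (n := n) (k := fun j => kParam G ℓ (levelPi G δ j)) hlam hδ hδ1
      hp hp1 hn1 ?_ (fun e he => hℓ ▸ load_pos_of_mem hi he) (fun e _ => hmax e)
      (fun j => numContracted_pos (Set.nonempty_of_ncard_ne_zero (by omega)) _)
      (fun j => hn ▸ numContracted_le_ncard _) (fun j _ => ?_) fun j => hrel j
    · have := (htree i hi).2.2
      omega
    · have h := card_heavy_le_kParam (hT i hi2) (τ := levelPi G δ j) hwℓ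
      rwa [show 2 * (2 * δ / lam) = 4 * δ / lam by ring] at h
  have hbad : ∑ C : Finset E with IsCut G C ∧ 2 * Real.log n < ∑ e ∈ C, ℓ e, p ^ C.card ≤
      p ^ minCut G * Real.exp (Real.log n - 2 * Real.log n) := by
    subst hℓ
    refine sum_pow_card_le_of_load (η := 2 / Real.log n) ⟨M, by simp [hM0]⟩ htree hp hp1
      (by linarith) (fun i hi => ?_) (fun C hC => (Finset.mem_filter.1 hC).2.1) (fun C hC => ?_)
      fun C hC => (Finset.mem_filter.1 hC).2.2.le
    · rw [← Finset.mul_sum]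
      refine le_trans (mul_le_mul Real.exp_one_lt_three.le (hlevels i hi) ?_ (by norm_num)) hn2
      exact Finset.sum_nonneg fun e _ => by positivity
    · -- Every load is below `4 / λ`, so a cut of load `2 * log n` has at least
      -- `λ * log n / 2` edges.
      have h1 := (Finset.mem_filter.1 hC).2.2
      have h2 : ∑ e ∈ C, load T (Finset.Ico M (2 * M)) e ≤ C.card * (4 / lam) := by
        rw [← nsmul_eq_mul]
        refine Finset.sum_le_card_nsmul _ _ _ fun e _ => (hmax e).trans ?_
        gcongr
        linarith
      have h3 := h1.trans_le h2
      rw [mul_div_assoc', lt_div_iff₀ hlam] at h3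
      rw [div_mul_eq_mul_div, le_div_iff₀ hlog]
      linarith
  have hexp : Real.exp (Real.log n - 2 * Real.log n) = 1 / n := by
    rw [show Real.log n - 2 * Real.log n = -Real.log n by ring, Real.exp_neg, Real.exp_log hn0,
      one_div]
  rw [hexp] at hbad
  have hz := pow_minCut_le_zG (G := G) (by omega) hp.le
  have hle : p ^ minCut G * (1 / n) ≤ zG G p * (1 / n) := by gcongr
  have hsplit := zG_eq_zGRestricted_add (G := G) ℓ (2 * Real.log n) p
  linarith

lemma zGRestricted_nonneg [Fintype E] (ℓ : E → ℝ) (b : ℝ) {p : ℝ} (hp : 0 ≤ p) :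
    0 ≤ zGRestricted G ℓ b p :=
  Finset.sum_nonneg fun _ _ => by positivity

/-- The growth conditions under which `δ = Θ(1 / log log n)` is small enough. -/
lemma eventually_log_log_bounds (a b : ℝ) (ha : 0 < a) : ∀ᶠ n : ℕ in Filter.atTop,
    1 ≤ Real.log (Real.log n) ∧ b ≤ Real.log (Real.log n) ∧
      a * Real.log (Real.log n) + 9 ≤ Real.log n := by
  have hL : Filter.Tendsto (fun n : ℕ => Real.log n) Filter.atTop Filter.atTop :=
    Real.tendsto_log_atTop.comp tendsto_natCast_atTop_atTop
  have hLL := Real.tendsto_log_atTop.comp hL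
  filter_upwards [hLL.eventually_ge_atTop 1, hLL.eventually_ge_atTop b,
    hL.eventually_ge_atTop 18,
    hL.eventually (Real.isLittleO_log_id_atTop.bound (by positivity : 0 < 1 / (2 * a)))]
    with n h1 h2 h3 h4
  refine ⟨h1, h2, ?_⟩
  simp only [Function.comp_apply, id_eq, Real.norm_eq_abs] at h1 h4
  rw [abs_of_pos (by linarith), abs_of_pos (by linarith), one_div, ← div_eq_inv_mul,
    le_div_iff₀ (by positivity)] at h4
  linarith

end Reliable

end Unreliability

theorem mainTheorem10 (c₁ c₂ : ℝ) (hc₁ : 0 < c₁) (hc₂ : 0 < c₂) :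
    ∃ K : ℝ, 0 < K ∧
      ∀ (V E : Type*) [Fintype V] [Fintype E] (G : Graph V E) (n m : ℕ) (δ p : ℝ)
        (M : ℕ) (T : ℕ → Finset E) (ℓ : E → ℝ),
        n = G.vertexSet.ncard → m = G.edgeSet.ncard → 3 ≤ n →
        G.toSimpleGraph.Connected →
        0 < p → p < 1 →
        -- `δ = Θ(1 / log log n)`
        c₁ / Real.log (Real.log n) ≤ δ → δ ≤ c₂ / Real.log (Real.log n) →
        -- `𝒯` is the latter half of a greedy tree packing, `|𝒯| = M ≥ 6 λ ln m / (δ/3)²`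
        6 * (Unreliability.minCut G : ℝ) * Real.log m / (δ / 3) ^ 2 ≤ (M : ℝ) →
        Unreliability.IsGreedyTreePacking G (2 * M) T →
        ℓ = Unreliability.load T (Finset.Ico M (2 * M)) →
        -- the reliable case
        (∀ i : ℕ, (n : ℝ) ^ (1 + 30 * δ) *
          (Unreliability.kParam G ℓ (Unreliability.levelPi G δ i) : ℝ) *
          p ^ (2 * Unreliability.levelPi G δ i) ≤ 1) →
        (1 - K / n) * Unreliability.zG G p ≤
          Unreliability.zGRestricted G ℓ (2 * Real.log n) p := by
  obtain ⟨N, hN⟩ := Filter.eventually_atTop.1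
    (Unreliability.eventually_log_log_bounds (5 / c₁) (100 * c₂) (by positivity))
  refine ⟨N + 1, by positivity, ?_⟩
  intro V E _ _ G n m δ p M T ℓ hn hm hn3 hG hp hp1 hδl hδu hM hT hℓ hrel
  have hn0 : (0 : ℝ) < n := by exact_mod_cast (by omega : 0 < n)
  have hz : 0 ≤ Unreliability.zG G p :=
    (by positivity : 0 ≤ p ^ Unreliability.minCut G).trans
      (Unreliability.pow_minCut_le_zG (by omega) hp.le)
  rcases lt_or_ge n N with hnN | hnN
  · -- For small `n` the left-hand side is not positive.
    refine le_trans (mul_nonpos_of_nonpos_of_nonneg ?_ hz)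
      (Unreliability.zGRestricted_nonneg ℓ _ hp.le)
    rw [sub_nonpos, one_le_div hn0]
    have : (n : ℝ) ≤ N := by exact_mod_cast hnN.le
    linarith
  obtain ⟨h1, h2, h3⟩ := hN n hnN
  set LL := Real.log (Real.log n)
  have hLL : 0 < LL := by linarith
  have hδ : 0 < δ := lt_of_lt_of_le (by positivity) hδl
  have hδinv : 1 / δ ≤ LL / c₁ := by
    rw [div_le_div_iff₀ hδ hc₁]
    rw [div_le_iff₀ hLL] at hδl
    linarith
  have hlog : 5 * (1 / δ) + 9 ≤ Real.log n := by
    refine le_trans ?_ h3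
    rw [div_mul_eq_mul_div, mul_div_assoc]
    linarith
  have hδpos : 0 < 1 / δ := by positivity
  have hM0 : 0 < M := by
    obtain ⟨T₀, hT₀⟩ := Unreliability.exists_isSpanningTree hG
    have hlam : (0 : ℝ) < Unreliability.minCut G := by
      exact_mod_cast hT₀.minCut_pos (by omega)
    have hcard : T₀.card ≤ m := by
      rw [hm, ← Set.ncard_coe_finset]
      exact Set.ncard_le_ncard hT₀.1 (Set.toFinite _)
    have hm1 : 1 < m := by
      have := hT₀.2.2
      omega
    have hlogm : 0 < Real.log m := Real.log_pos (by exact_mod_cast hm1)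
    have : (0 : ℝ) < M := lt_of_lt_of_le (by positivity) hM
    exact_mod_cast this
  refine le_trans (mul_le_mul_of_nonneg_right ?_ hz)
    (Unreliability.one_sub_inv_mul_zG_le hn hm hn3 hp hp1 hδ ?_ ?_ ?_ hM0 hM hT hℓ hrel)
  · gcongr
    linarith [(Nat.cast_nonneg N : (0 : ℝ) ≤ N)]
  · refine hδu.trans ?_
    rw [div_le_div_iff₀ hLL (by norm_num)]
    linarith
  · rw [div_le_iff₀ (by linarith)]
    calc (2 : ℝ) ≤ δ / 2 * (5 * (1 / δ)) := by
          rw [show δ / 2 * (5 * (1 / δ)) = 5 / 2 by field_simp]; norm_num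
      _ ≤ δ / 2 * Real.log n := by gcongr; linarith
  · rw [show 3 / 2 / δ = 3 / 2 * (1 / δ) by ring]
    linarith
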